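/- Let $D\subseteq\overline{\mathbb C}=\mathbb C\cup\{\infty\}$ be a domain (a non-empty connected open subset of the Riemann sphere), and let $\mathscr F$ be a family of (finite-valued) analytic functions on $D$. Let $k\ge 1$ and let $q_0,q_1,\dots,q_k$ be integers with $q_0\ge 3$, $q_i\ge 0$ for $1\le i\le k-1$, and $q_k\ge 1$. Suppose that for every $f\in\mathscr F$ (i) every zero of $f$ in $D$ has multiplicity at least $k$ (identically vanishing $f$ is allowed), and (ii) $\big(f(z)\big)^{q_0}\big(f'(z)\big)^{q_1}\cdots\big(f^{(k)}(z)\big)^{q_k}\neq 1$ for every $z\in D$. Then $\mathscr F$ is normal on $D$: every sequence $(f_n)$ in $\mathscr F$ has a subsequence which converges, locally uniformly on $D$ with respect to the spherical (chordal) metric, either to an analytic function on $D$ or to the constant $\infty$. If $\infty\in D$, then analyticity and multiplicity of zeros at $\infty$ are those of $w\mapsto f(1/w)$ at $w=0$; the derivatives are taken with respect to $z$, and their values at $\infty$ are those of their analytic extensions (so $f^{(j)}(\infty)=0$ for $j\ge1$). -/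

import Mathlib

open Filter Topology

noncomputable section

namespace SphereNormal

/-- The local coordinate of the Riemann sphere `OnePoint ℂ` at `∞`: `w ↦ 1 / w`, with `0 ↦ ∞`. -/
def recip (w : ℂ) : OnePoint ℂ :=
  if w = 0 then OnePoint.infty else ((w⁻¹ : ℂ) : OnePoint ℂ)

/-- `f` is a (finite-valued) analytic function on the subset `D` of the Riemann sphere:
`z ↦ f z` is analytic at the finite points of `D`, and, if `∞ ∈ D`,
`w ↦ f (1 / w)` is analytic at `0`. Values of `f` outside `D` are irrelevant when `D` is open. -/
def AnalyticOnSphere (f : OnePoint ℂ → ℂ) (D : Set (OnePoint ℂ)) : Prop :=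
  (∀ z : ℂ, (z : OnePoint ℂ) ∈ D → AnalyticAt ℂ (fun x : ℂ => f (x : OnePoint ℂ)) z) ∧
    (OnePoint.infty ∈ D → AnalyticAt ℂ (fun w : ℂ => f (recip w)) 0)

/-- The multiplicity of `f` as a zero at the point `p` of the sphere, in the local coordinate
(`⊤` if `f` vanishes identically near `p`). -/
def zeroMult (f : OnePoint ℂ → ℂ) : OnePoint ℂ → ℕ∞
  | none => analyticOrderAt (fun w : ℂ => f (recip w)) 0
  | some z => analyticOrderAt (fun x : ℂ => f (x : OnePoint ℂ)) z

/-- The derivative `f' = df/dz`, as a function on the sphere. Near `∞`, with `w = 1 / z`, one has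
`df/dz = - w ^ 2 * (d/dw) f (1 / w)`, so the derivative of a function that is analytic at `∞`
extends analytically to `∞` with the value `0`; see `AnalyticOnSphere.sderiv`. -/
def sderiv (f : OnePoint ℂ → ℂ) : OnePoint ℂ → ℂ
  | none => 0
  | some z => deriv (fun x : ℂ => f (x : OnePoint ℂ)) z

/-- The differential monomial `f ^ q₀ * (f') ^ q₁ * ⋯ * (f⁽ᵏ⁾) ^ qₖ`. -/
def monomial (k : ℕ) (q : ℕ → ℕ) (f : OnePoint ℂ → ℂ) (p : OnePoint ℂ) : ℂ :=
  ∏ i ∈ Finset.range (k + 1), (sderiv^[i] f p) ^ q i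

/-- The chordal (spherical) distance on the Riemann sphere. -/
def chordal : OnePoint ℂ → OnePoint ℂ → ℝ
  | none, none => 0
  | none, some w => 2 / √(1 + ‖w‖ ^ 2)
  | some z, none => 2 / √(1 + ‖z‖ ^ 2)
  | some z, some w => 2 * ‖z - w‖ / (√(1 + ‖z‖ ^ 2) * √(1 + ‖w‖ ^ 2))

/-- `F n → g` spherically and locally uniformly on `D`. -/
def TendstoSpherically (F : ℕ → OnePoint ℂ → ℂ) (g : OnePoint ℂ → OnePoint ℂ)
    (D : Set (OnePoint ℂ)) : Prop :=
  TendstoLocallyUniformlyOn (fun n p => chordal (F n p : OnePoint ℂ) (g p)) (fun _ => (0 : ℝ))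
    atTop D

/-- A family of analytic functions on `D` is normal if every sequence in it has a subsequence that
converges spherically and locally uniformly on `D` to an analytic function or to `∞`. -/
def IsNormalOn (𝓕 : Set (OnePoint ℂ → ℂ)) (D : Set (OnePoint ℂ)) : Prop :=
  ∀ F : ℕ → OnePoint ℂ → ℂ, (∀ n, F n ∈ 𝓕) →
    ∃ φ : ℕ → ℕ, StrictMono φ ∧
      ((∃ g : OnePoint ℂ → ℂ, AnalyticOnSphere g D ∧
          TendstoSpherically (fun n => F (φ n)) (fun p => (g p : OnePoint ℂ)) D) ∨
        TendstoSpherically (fun n => F (φ n)) (fun _ => OnePoint.infty) D)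

/-- At finite points the iterates of `sderiv` are the usual derivatives. -/
theorem sderiv_iterate_coe (f : OnePoint ℂ → ℂ) (i : ℕ) (z : ℂ) :
    sderiv^[i] f (z : OnePoint ℂ) = iteratedDeriv i (fun x : ℂ => f (x : OnePoint ℂ)) z := by
  induction i generalizing z with
  | zero => simp
  | succ n ih =>
    rw [Function.iterate_succ_apply', iteratedDeriv_succ]
    change deriv (fun x : ℂ => sderiv^[n] f (x : OnePoint ℂ)) z = _
    rw [funext ih]

/-- The derivative of an analytic function on an open subset of the sphere is analytic there, also
at `∞`; this determines its value at `∞`. -/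
theorem AnalyticOnSphere.sderiv {f : OnePoint ℂ → ℂ} {D : Set (OnePoint ℂ)}
    (hf : AnalyticOnSphere f D) : AnalyticOnSphere (sderiv f) D := by
  refine ⟨fun z hz => (hf.1 z hz).deriv, fun h => ?_⟩
  have h0 := hf.2 h
  have h1 : AnalyticAt ℂ (fun w : ℂ => -w ^ 2 * deriv (fun w : ℂ => f (recip w)) w) 0 :=
    ((analyticAt_id.pow 2).neg).mul h0.deriv
  refine h1.congr ?_
  filter_upwards [h0.eventually_analyticAt] with w hw
  by_cases hw0 : w = 0
  · simp [hw0, recip, SphereNormal.sderiv]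
  · have e : recip w = ((w⁻¹ : ℂ) : OnePoint ℂ) := by simp [recip, hw0]
    rw [e]
    change _ = deriv (fun x : ℂ => f (x : OnePoint ℂ)) w⁻¹
    have hx : w⁻¹ ≠ 0 := inv_ne_zero hw0
    have ev : (fun x : ℂ => f (x : OnePoint ℂ)) =ᶠ[𝓝 w⁻¹]
        (fun w : ℂ => f (recip w)) ∘ (fun x : ℂ => x⁻¹) := by
      filter_upwards [isOpen_ne.mem_nhds hx] with x hx'
      have : x ≠ 0 := hx'
      simp [recip, this]
    have hd : HasDerivAt (fun w : ℂ => f (recip w)) (deriv (fun w : ℂ => f (recip w)) w)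
        (w⁻¹)⁻¹ := by
      rw [inv_inv]; exact hw.differentiableAt.hasDerivAt
    rw [ev.deriv_eq, (hd.comp w⁻¹ (hasDerivAt_inv hx)).deriv]
    field_simp

end SphereNormal

end

/-!
The proof uses no Nevanlinna theory. It rests on the following ideas.

*Scaling.* Let `α = (∑ i q_i) / (∑ q_i)`. The differential monomial `M[f] = ∏ (f⁽ⁱ⁾) ^ q_i` is
invariant under `f ↦ s ^ (-α) f (c + s z)`, and so are both hypotheses. Since `q₀, q_k ≥ 1`, we have
`0 < α < k` (`scalingExponent_pos`, `scalingExponent_lt`), and as the zeros of `f` have multiplicity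
at least `k`, Zalcman's rescaling is available: near a point where `f` is large in the sense of the
scale invariant spherical derivative there is a best such point, and the function rescaled there has
bounded derivative on the set where its modulus is `1`.

*Growth.* A holomorphic function with `‖f'‖ ≤ C` on `{‖f‖ = 1}` grows at most like `exp (2 C ‖z‖)`
(`norm_le_exp_of_deriv_le_on_level`): a Hopf lemma for `log ‖f‖` at a point of `{‖f‖ ≤ 1}` nearest
to `z`. So limits of rescaled functions exist by Montel's theorem and are nonconstant entire functions `g`
of exponential type, and a Marty type criterion is not needed.

*A Picard type lemma* (`ExpType.diffMonomial_eq_zero`). By Hurwitz's theorem `M[g]` omits `1` or is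
identically `1`. Zero-free entire functions of exponential type are of the form `exp (a z + b)`. If
`g` has no zeros, this makes `M[g]` surjective onto `ℂ \ {0}`, unless `g` is constant. Otherwise
`M[g]` omits `1`, so that `M[g] = 1 + exp (a z + b)`; a zero of `g` is a multiple zero of `M[g]`,
because `q₀ ≥ 2`, so `a = 0` and `M[g] = 0`. Then `g` is a polynomial of degree less than `k`
whose zeros have multiplicity at least `k`, which is absurd. This gives normality in the plane
(`exists_subseq_convergesOn_of_admissible`).

*The point at infinity* (`exists_subseq_convergesOn_of_admissible_inv`). In the coordinate
`w = 1 / z` the derivative is `δ = - w ^ 2 d/dw`. By the planar case a subsequence converges on a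
punctured disc about `w = 0`. A finite limit extends by the maximum principle. If the limit is `∞`,
it is enough that the functions have no zeros near `w = 0`, by the minimum principle. Rescaling
`w` by the largest modulus of a point with `‖f‖ ≤ ‖w‖ ^ (-α)` yields an entire limit `G` of
exponential type with `∏ (δ^i G) ^ q_i ≠ 1`. This product has a multiple zero at `w = 0`, hence it
vanishes identically, `G` is a nonzero constant, and zeros are excluded.

*Globalization* (`exists_subseq_convergesOn`). Local convergence, to a finite function or to `∞`,
passes to a domain by a diagonal sequence and connectedness.
-/

namespace SphereNormal

open Metric Set

/-! ### Logarithms and the Schwarz lemma for a half-plane -/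

theorem exists_eq_exp_of_isExactOn {U : Set ℂ} (hUo : IsOpen U) (hU : IsPreconnected U) {f : ℂ → ℂ}
    (hf : DifferentiableOn ℂ f U) (h0 : ∀ z ∈ U, f z ≠ 0)
    (hE : Complex.IsExactOn (fun z => deriv f z / f z) U) :
    ∃ h : ℂ → ℂ, DifferentiableOn ℂ h U ∧ ∀ z ∈ U, f z = Complex.exp (h z) := by
  rcases U.eq_empty_or_nonempty with rfl | ⟨x, hx⟩
  · exact ⟨0, by simp, by simp⟩
  obtain ⟨g, hgx, hg⟩ := hE.with_val_at x (Complex.log (f x))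
  refine ⟨g, fun z hz => (hg z hz).differentiableAt.differentiableWithinAt, fun z hz => ?_⟩
  have hfd : ∀ z ∈ U, HasDerivAt f (deriv f z) z := fun z hz =>
    (hf.differentiableAt (hUo.mem_nhds hz)).hasDerivAt
  have hF : ∀ z ∈ U, HasDerivAt (fun z => f z * Complex.exp (-g z)) 0 z := by
    intro z hz
    refine ((hfd z hz).mul (hg z hz).neg.cexp).congr_deriv ?_
    simp only [Pi.neg_apply]
    rw [mul_neg, mul_neg, ← mul_assoc, mul_right_comm, mul_div_cancel₀ _ (h0 z hz)]
    ring
  have hc := hUo.is_const_of_deriv_eq_zero hU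
    (fun z hz => (hF z hz).differentiableAt.differentiableWithinAt) (fun z hz => (hF z hz).deriv)
    hz hx
  simp only [hgx, Complex.exp_neg, Complex.exp_log (h0 x hx), mul_inv_cancel₀ (h0 x hx)] at hc
  rwa [← div_eq_mul_inv, div_eq_one_iff_eq (Complex.exp_ne_zero _)] at hc

theorem exists_eq_exp_on_ball {c : ℂ} {R : ℝ} {f : ℂ → ℂ} (hf : DifferentiableOn ℂ f (ball c R))
    (h0 : ∀ z ∈ ball c R, f z ≠ 0) :
    ∃ h : ℂ → ℂ, DifferentiableOn ℂ h (ball c R) ∧ ∀ z ∈ ball c R, f z = Complex.exp (h z) :=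
  exists_eq_exp_of_isExactOn isOpen_ball (convex_ball c R).isPreconnected hf h0
    ((hf.deriv isOpen_ball).div hf h0).isExactOn_ball

theorem exists_eq_exp {f : ℂ → ℂ} (hf : Differentiable ℂ f) (h0 : ∀ z, f z ≠ 0) :
    ∃ h : ℂ → ℂ, Differentiable ℂ h ∧ ∀ z, f z = Complex.exp (h z) := by
  obtain ⟨h, hh, he⟩ := exists_eq_exp_of_isExactOn isOpen_univ isPreconnected_univ
    hf.differentiableOn (fun z _ => h0 z) (hf.deriv.div hf h0).isExactOn_univ
  exact ⟨h, differentiableOn_univ.1 hh, fun z => he z (mem_univ z)⟩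

/-- The Cayley transform with pole at `-conj b` maps the right half-plane to the unit disc. -/
theorem norm_sub_le_norm_add_conj {a b : ℂ} (ha : 0 ≤ a.re) (hb : 0 ≤ b.re) :
    ‖a - b‖ ≤ ‖a + (starRingEnd ℂ) b‖ := by
  rw [← sq_le_sq₀ (norm_nonneg _) (norm_nonneg _), ← Complex.normSq_eq_norm_sq,
    ← Complex.normSq_eq_norm_sq, Complex.normSq_apply, Complex.normSq_apply]
  simp
  nlinarith [mul_nonneg ha hb]

/-- The Schwarz lemma at the centre of a disc for functions with values in the right half-plane,
obtained by composing with the Cayley transform that sends `h c` to `0`. -/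
theorem cayley_schwarz {c : ℂ} {R : ℝ} (hR : 0 < R) {h : ℂ → ℂ}
    (hh : DifferentiableOn ℂ h (ball c R)) (hpos : ∀ z ∈ ball c R, 0 < (h z).re) :
    (∀ w ∈ ball c R, ‖h w - h c‖ * R ≤ ‖w - c‖ * ‖h w + (starRingEnd ℂ) (h c)‖) ∧
      ‖deriv h c‖ * R ≤ 2 * (h c).re := by
  have hc : c ∈ ball c R := mem_ball_self hR
  have hne : ∀ w ∈ ball c R, h w + (starRingEnd ℂ) (h c) ≠ 0 := by
    intro w hw h0
    have := congrArg Complex.re h0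
    simp at this
    linarith [hpos w hw, hpos c hc]
  set φ : ℂ → ℂ := fun w => (h w - h c) / (h w + (starRingEnd ℂ) (h c)) with hφ
  have hφd : DifferentiableOn ℂ φ (ball c R) :=
    (hh.sub_const _).div (hh.add_const _) hne
  have hφc : φ c = 0 := by simp [hφ]
  have hmap : MapsTo φ (ball c R) (closedBall (φ c) 1) := by
    intro w hw
    rw [hφc, mem_closedBall_zero_iff, hφ]
    simp only [norm_div]
    exact div_le_one_of_le₀ (norm_sub_le_norm_add_conj (hpos w hw).le (hpos c hc).le)
      (norm_nonneg _)
  constructor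
  · intro w hw
    have := Complex.dist_le_div_mul_dist_of_mapsTo_ball hφd hmap hw
    rw [hφc, dist_zero_right, dist_eq_norm, hφ] at this
    simp only [norm_div] at this
    rw [div_le_iff₀ (norm_pos_iff.2 (hne w hw)), mul_assoc, one_div, ← div_eq_inv_mul,
      le_div_iff₀ hR] at this
    exact this
  · have h1 := Complex.norm_deriv_le_div_of_mapsTo_ball hφd hmap hR
    have hd : HasDerivAt h (deriv h c) c :=
      (hh.differentiableAt (isOpen_ball.mem_nhds hc)).hasDerivAt
    have h2 := (hd.sub_const (h c)).div (hd.add_const ((starRingEnd ℂ) (h c))) (hne c hc)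
    have h3 : HasDerivAt φ _ c := h2
    have h4 : h c + (starRingEnd ℂ) (h c) = ((2 * (h c).re : ℝ) : ℂ) := Complex.add_conj _
    have hp := hpos c hc
    have hp' : (2 * (h c).re : ℝ) ≠ 0 := by positivity
    have h5 : deriv φ c = deriv h c / ((2 * (h c).re : ℝ) : ℂ) := by
      rw [h3.deriv, h4]
      have : ((2 * (h c).re : ℝ) : ℂ) ≠ 0 := by exact_mod_cast hp'
      field_simp
      simp
    rw [h5, norm_div, Complex.norm_real, Real.norm_of_nonneg (by positivity),
      div_le_div_iff₀ (by positivity) hR] at h1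
    linarith

/-- Harnack's inequality for the positive harmonic function `log ‖f‖`. -/
theorem harnack_log_norm {c : ℂ} {R : ℝ} {f : ℂ → ℂ} (hf : DifferentiableOn ℂ f (ball c R))
    (h1 : ∀ z ∈ ball c R, 1 < ‖f z‖) {w : ℂ} (hw : w ∈ ball c R) :
    Real.log ‖f c‖ * (R - ‖w - c‖) ≤ Real.log ‖f w‖ * (R + ‖w - c‖) := by
  have hR : 0 < R := nonempty_ball.1 ⟨w, hw⟩
  obtain ⟨h, hh, he⟩ := exists_eq_exp_on_ball hf fun z hz h0 => by
    have := h1 z hz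
    simp [h0] at this
    linarith
  have hlog : ∀ z ∈ ball c R, Real.log ‖f z‖ = (h z).re := fun z hz => by
    rw [he z hz, Complex.norm_exp, Real.log_exp]
  have hpos : ∀ z ∈ ball c R, 0 < (h z).re := fun z hz => by
    rw [← hlog z hz]
    exact Real.log_pos (h1 z hz)
  have hc : c ∈ ball c R := mem_ball_self hR
  rw [hlog c hc, hlog w hw]
  have key := (cayley_schwarz hR hh hpos).1 w hw
  have hwR : ‖w - c‖ < R := by rwa [mem_ball, dist_eq_norm] at hw
  have hρ0 : 0 ≤ ‖w - c‖ := norm_nonneg _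
  generalize ‖w - c‖ = ρ at key hwR hρ0 ⊢
  have hp := hpos c hc
  have hx := hpos w hw
  have k2 : (‖h w - h c‖ * R) ^ 2 ≤ (ρ * ‖h w + (starRingEnd ℂ) (h c)‖) ^ 2 := by gcongr
  rw [mul_pow, mul_pow, ← Complex.normSq_eq_norm_sq, ← Complex.normSq_eq_norm_sq,
    Complex.normSq_apply, Complex.normSq_apply] at k2
  simp at k2
  have k3 : ((h c).re - (h w).re) * R ≤ ρ * ((h w).re + (h c).re) := by
    refine le_of_abs_le (abs_le_of_sq_le_sq ?_ (by positivity))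
    nlinarith [mul_nonneg (sq_nonneg ((h w).im - (h c).im)) (sub_nonneg.2 (pow_le_pow_left₀ hρ0 hwR.le 2))]
  nlinarith

/-- The derivative at the centre of a holomorphic logarithm of `f`, whose real part `log ‖f‖` is
positive. -/
theorem norm_deriv_mul_le_of_one_lt_norm {c : ℂ} {R : ℝ} (hR : 0 < R) {f : ℂ → ℂ}
    (hf : DifferentiableOn ℂ f (ball c R)) (h1 : ∀ z ∈ ball c R, 1 < ‖f z‖) :
    ‖deriv f c‖ * R ≤ 2 * ‖f c‖ * Real.log ‖f c‖ := by
  obtain ⟨h, hh, he⟩ := exists_eq_exp_on_ball hf fun z hz h0 => by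
    have := h1 z hz
    simp [h0] at this
    linarith
  have hlog : ∀ z ∈ ball c R, Real.log ‖f z‖ = (h z).re := fun z hz => by
    rw [he z hz, Complex.norm_exp, Real.log_exp]
  have hpos : ∀ z ∈ ball c R, 0 < (h z).re := fun z hz => by
    rw [← hlog z hz]
    exact Real.log_pos (h1 z hz)
  have hc : c ∈ ball c R := mem_ball_self hR
  have key := (cayley_schwarz hR hh hpos).2
  have hd : HasDerivAt h (deriv h c) c :=
    (hh.differentiableAt (isOpen_ball.mem_nhds hc)).hasDerivAt
  have hev : f =ᶠ[𝓝 c] fun z => Complex.exp (h z) := by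
    filter_upwards [isOpen_ball.mem_nhds hc] with z hz using he z hz
  rw [hev.deriv_eq, hd.cexp.deriv, norm_mul, ← he c hc, hlog c hc]
  nlinarith [norm_nonneg (f c)]

/-- If `‖f‖ > 1` on the unit disc about `c`, the spherical derivative at `c`, taken without the factor
`2`, is less than `1`, because `2 x log x < 1 + x ^ 2` for `x ≥ 1`. -/
theorem norm_deriv_lt_one_add_sq {c : ℂ} {f : ℂ → ℂ}
    (hf : DifferentiableOn ℂ f (ball c 1)) (h1 : ∀ z ∈ ball c 1, 1 < ‖f z‖) :
    ‖deriv f c‖ < 1 + ‖f c‖ ^ 2 := by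
  have h2 := norm_deriv_mul_le_of_one_lt_norm one_pos hf h1
  have h3 := h1 c (mem_ball_self one_pos)
  set x := ‖f c‖
  set y := √x
  have hy : y ^ 2 = x := Real.sq_sqrt (by linarith)
  have hy1 : 1 ≤ y := Real.one_le_sqrt.2 h3.le
  have h4 : Real.log x ≤ 2 * (y - 1) := by
    rw [← hy, Real.log_pow]
    have := Real.log_le_sub_one_of_pos (show 0 < y by linarith)
    push_cast
    linarith
  have h5 : 2 * x * Real.log x ≤ 2 * x * (2 * (y - 1)) := by gcongr
  rw [mul_one] at h2
  have h6 : 2 * x * (2 * (y - 1)) < 1 + x ^ 2 := by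
    rw [← hy]
    nlinarith [sq_nonneg (y ^ 2 - 2 * y)]
  linarith

/-! ### Growth of functions with bounded derivative on the level set `‖f‖ = 1` -/

/-- If `‖f‖ > 1` on a disc with a boundary point `p` such that `‖f p‖ = 1`, then `log ‖f‖` at the
centre is controlled by the derivative at `p`: a Hopf lemma. -/
theorem log_norm_le_of_norm_eq_one {z p : ℂ} {f : ℂ → ℂ} (hzp : z ≠ p)
    (hf : DifferentiableOn ℂ f (ball z ‖p - z‖)) (hfp : DifferentiableAt ℂ f p)
    (h1 : ∀ w ∈ ball z ‖p - z‖, 1 < ‖f w‖) (hp : ‖f p‖ = 1) :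
    Real.log ‖f z‖ ≤ 2 * ‖p - z‖ * ‖deriv f p‖ := by
  set d := ‖p - z‖ with hd
  have hd0 : 0 < d := norm_pos_iff.2 (sub_ne_zero.2 hzp.symm)
  -- difference quotients along the radius from `p` to `z`
  have hslope : Tendsto (fun t : ℝ => ‖t⁻¹ • (f (p + t • (z - p)) - f p)‖) (𝓝[>] 0)
      (𝓝 ‖deriv f p * (z - p)‖) := by
    have h2 : HasDerivAt (fun t : ℝ => f (p + t • (z - p))) (deriv f p * (z - p)) 0 := by
      have h3 : HasDerivAt (fun t : ℝ => p + t • (z - p)) (z - p) 0 := by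
        simpa using ((hasDerivAt_id (0 : ℝ)).smul_const (z - p)).const_add p
      have h4 : HasDerivAt f (deriv f p) (p + (0 : ℝ) • (z - p)) := by
        simpa using hfp.hasDerivAt
      exact h4.comp_of_eq (0 : ℝ) h3 rfl
    have h5 := h2.tendsto_slope_zero_right
    simpa using h5.norm
  have hle : ∀ᶠ t : ℝ in 𝓝[>] 0,
      Real.log ‖f z‖ ≤ 2 * ‖t⁻¹ • (f (p + t • (z - p)) - f p)‖ := by
    filter_upwards [Ioo_mem_nhdsGT (show (0 : ℝ) < 1 by norm_num)] with t ht
    set w := p + t • (z - p)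
    have hw : ‖w - z‖ = (1 - t) * d := by
      have : w - z = ((1 - t : ℝ) : ℂ) * (p - z) := by
        simp only [w, Complex.real_smul]; push_cast; ring
      rw [this, norm_mul, Complex.norm_real, Real.norm_of_nonneg (by linarith [ht.2])]
    have hwb : w ∈ ball z d := by
      rw [mem_ball, dist_eq_norm, hw]; nlinarith [ht.1]
    have h2 := harnack_log_norm hf h1 hwb
    rw [hw] at h2
    have h3 : Real.log ‖f w‖ ≤ ‖f w - f p‖ := by
      have := Real.log_le_sub_one_of_pos (show 0 < ‖f w‖ by linarith [h1 w hwb])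
      have := norm_sub_norm_le (f w) (f p)
      linarith
    have h4 : 0 < Real.log ‖f w‖ := Real.log_pos (h1 w hwb)
    rw [norm_smul, norm_inv, Real.norm_of_nonneg ht.1.le, ← mul_assoc, mul_comm 2, mul_assoc,
      ← div_eq_inv_mul, le_div_iff₀ ht.1]
    have h5 : Real.log ‖f z‖ * t * d ≤ 2 * Real.log ‖f w‖ * d := by
      nlinarith [mul_pos h4 hd0, mul_pos (mul_pos h4 hd0) ht.1]
    have := le_of_mul_le_mul_right h5 hd0
    linarith
  have := ge_of_tendsto (hslope.const_mul 2) hle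
  rw [norm_mul, norm_sub_rev z p] at this
  linarith

/-- A bound for the derivative on the level set `‖f‖ = 1` controls the growth of `f`. -/
theorem norm_le_exp_of_deriv_le_on_level {c : ℂ} {R C : ℝ} {f : ℂ → ℂ} (hC : 0 ≤ C)
    (hf : DifferentiableOn ℂ f (ball c R)) (hd : ∀ z ∈ ball c R, ‖f z‖ = 1 → ‖deriv f z‖ ≤ C)
    (hc : ‖f c‖ ≤ 1) {z : ℂ} (hz : 2 * ‖z - c‖ < R) : ‖f z‖ ≤ Real.exp (2 * C * ‖z - c‖) := by
  rcases le_or_gt ‖f z‖ 1 with h1 | h1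
  · exact h1.trans (Real.one_le_exp (by positivity))
  have hsub : closedBall z ‖z - c‖ ⊆ ball c R := by
    intro w hw
    rw [mem_closedBall, dist_eq_norm] at hw
    rw [mem_ball, dist_eq_norm]
    have := norm_sub_le_norm_sub_add_norm_sub w z c
    linarith
  -- `p` is a point of `{‖f‖ ≤ 1}` nearest to `z`
  have hcont : ContinuousOn f (closedBall z ‖z - c‖) := hf.continuousOn.mono hsub
  have hcomp : IsCompact (closedBall z ‖z - c‖ ∩ {w | ‖f w‖ ≤ 1}) := by
    refine (isCompact_closedBall z ‖z - c‖).of_isClosed_subset ?_ inter_subset_left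
    exact hcont.norm.preimage_isClosed_of_isClosed isClosed_closedBall (isClosed_Iic (a := (1 : ℝ)))
  obtain ⟨p, ⟨hpb, hp1⟩, hmin⟩ := hcomp.exists_isMinOn (f := fun w => ‖w - z‖)
    ⟨c, by simp [dist_eq_norm, norm_sub_rev], hc⟩ (by fun_prop)
  have hpz : ‖p - z‖ ≤ ‖z - c‖ := by rwa [mem_closedBall, dist_eq_norm] at hpb
  have hbig : ∀ w ∈ ball z ‖p - z‖, 1 < ‖f w‖ := by
    intro w hw
    rw [mem_ball, dist_eq_norm] at hw
    by_contra! hcon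
    have := isMinOn_iff.1 hmin w ⟨by rw [mem_closedBall, dist_eq_norm]; linarith, hcon⟩
    linarith
  have hzp : z ≠ p := by
    rintro rfl
    exact absurd hp1 (not_le.2 h1)
  have hd0 : ‖p - z‖ ≠ 0 := norm_ne_zero_iff.2 (sub_ne_zero.2 hzp.symm)
  have hpR : p ∈ ball c R := hsub hpb
  have hfp : DifferentiableAt ℂ f p := hf.differentiableAt (isOpen_ball.mem_nhds hpR)
  have hfp1 : ‖f p‖ = 1 := by
    refine le_antisymm hp1 ?_
    have hcl : p ∈ closure (ball z ‖p - z‖) := by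
      rw [closure_ball z hd0, mem_closedBall, dist_eq_norm]
    have hcw : ContinuousWithinAt (fun w => ‖f w‖) (ball z ‖p - z‖) p :=
      hfp.continuousAt.norm.continuousWithinAt
    have := mem_closure_iff_nhdsWithin_neBot.1 hcl
    exact ge_of_tendsto hcw (eventually_nhdsWithin_of_forall fun w hw => (hbig w hw).le)
  have hkey := log_norm_le_of_norm_eq_one hzp
    (hf.mono ((ball_subset_closedBall.trans (closedBall_subset_closedBall hpz)).trans hsub)) hfp
    hbig hfp1
  rw [← Real.log_le_iff_le_exp (by linarith)]
  have h2 := hd p hpR hfp1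
  calc _ ≤ 2 * ‖p - z‖ * ‖deriv f p‖ := hkey
    _ ≤ 2 * ‖z - c‖ * C := by gcongr
    _ = _ := by ring

/-! ### Theorems of Hurwitz and Montel -/

/-- The minimum principle for zero-free functions. -/
theorem le_norm_of_le_norm_sphere {c : ℂ} {ρ m : ℝ} (hρ : 0 < ρ) (hm : 0 < m) {f : ℂ → ℂ}
    (hf : DifferentiableOn ℂ f (closedBall c ρ)) (h0 : ∀ z ∈ closedBall c ρ, f z ≠ 0)
    (h : ∀ z ∈ sphere c ρ, m ≤ ‖f z‖) {z : ℂ} (hz : z ∈ closedBall c ρ) : m ≤ ‖f z‖ := by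
  have hinv : DiffContOnCl ℂ (fun z => (f z)⁻¹) (ball c ρ) :=
    (hf.inv h0).diffContOnCl_ball subset_rfl
  have := Complex.norm_le_of_forall_mem_frontier_norm_le (C := m⁻¹) isBounded_ball hinv
    (fun w hw => by
      rw [frontier_ball c hρ.ne'] at hw
      rw [norm_inv]
      exact inv_anti₀ hm (h w hw)) (by rwa [closure_ball c hρ.ne'])
  rw [norm_inv] at this
  exact (inv_le_inv₀ (norm_pos_iff.2 (h0 z hz)) hm).1 this

/-- **Hurwitz's theorem**: zeros of the limit are limits of zeros. -/
theorem eventually_exists_zero {ι : Type*} {L : Filter ι} {F : ι → ℂ → ℂ} {f : ℂ → ℂ} {U : Set ℂ}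
    (hU : IsOpen U) (hF : ∀ᶠ n in L, DifferentiableOn ℂ (F n) U)
    (h : TendstoLocallyUniformlyOn F f L U) {z₀ : ℂ} (hz₀ : z₀ ∈ U) (h0 : f z₀ = 0)
    (hne : ¬ ∀ᶠ z in 𝓝 z₀, f z = 0) {r : ℝ} (hr : 0 < r) :
    ∀ᶠ n in L, ∃ z ∈ ball z₀ r, F n z = 0 := by
  rcases L.eq_or_neBot with rfl | hL
  · simp
  have hfd := h.differentiableOn hF hU
  have hfa : AnalyticAt ℂ f z₀ := hfd.analyticAt (hU.mem_nhds hz₀)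
  have hnz := hfa.eventually_eq_zero_or_eventually_ne_zero.resolve_left hne
  rw [eventually_nhdsWithin_iff] at hnz
  obtain ⟨ε, hε, hsub⟩ := Metric.eventually_nhds_iff_ball.1
    (hnz.and ((hU.eventually_mem hz₀).and (isOpen_ball.eventually_mem (mem_ball_self hr))))
  have hρ : 0 < ε / 2 := half_pos hε
  have hsub' : closedBall z₀ (ε / 2) ⊆ ball z₀ ε := closedBall_subset_ball (half_lt_self hε)
  have hcU : closedBall z₀ (ε / 2) ⊆ U := fun z hz => (hsub z (hsub' hz)).2.1
  obtain ⟨p, hp, hpmin⟩ := (isCompact_sphere z₀ (ε / 2)).exists_isMinOn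
    (NormedSpace.sphere_nonempty.2 hρ.le)
    ((hfd.continuousOn.mono (sphere_subset_closedBall.trans hcU)).norm)
  have hm : 0 < ‖f p‖ := norm_pos_iff.2 <|
    (hsub p (hsub' (sphere_subset_closedBall hp))).1 (ne_of_mem_sphere hp hρ.ne')
  have hunif := (tendstoLocallyUniformlyOn_iff_forall_isCompact hU).1 h _ hcU
    (isCompact_closedBall z₀ (ε / 2))
  filter_upwards [hF, Metric.tendstoUniformlyOn_iff.1 hunif (‖f p‖ / 3) (by positivity)]
    with n hn hclose
  by_contra! hcon
  have hz0 := hclose z₀ (mem_closedBall_self hρ.le)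
  rw [h0, dist_zero_left] at hz0
  have := le_norm_of_le_norm_sphere (m := ‖f p‖ / 2) hρ (by positivity) (hn.mono hcU)
    (fun z hz => hcon z (hsub z (hsub' hz)).2.2) (fun z hz => by
      have h1 := hclose z (sphere_subset_closedBall hz)
      have h2 := isMinOn_iff.1 hpmin z hz
      rw [dist_eq_norm] at h1
      have := norm_sub_norm_le (f z) (F n z)
      linarith) (mem_closedBall_self hρ.le)
  linarith

/-- **Montel's theorem** on a disc. -/
theorem exists_subseq_tendstoUniformlyOn {F : ℕ → ℂ → ℂ} {c : ℂ} {r B : ℝ} (hr : 0 < r)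
    (hF : ∀ n, DifferentiableOn ℂ (F n) (ball c (2 * r)))
    (hB : ∀ n, ∀ z ∈ ball c (2 * r), ‖F n z‖ ≤ B) :
    ∃ φ : ℕ → ℕ, StrictMono φ ∧ ∃ g : ℂ → ℂ,
      TendstoUniformlyOn (fun n => F (φ n)) g atTop (closedBall c r) := by
  have hsub : closedBall c r ⊆ ball c (2 * r) := closedBall_subset_ball (by linarith)
  have hlip : ∀ n, ∀ x ∈ closedBall c r, ∀ y ∈ closedBall c r,
      ‖F n y - F n x‖ ≤ B / (r / 2) * ‖y - x‖ := by
    intro n x hx y hy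
    refine Convex.norm_image_sub_le_of_norm_deriv_le (fun z hz => (hF n).differentiableAt
      (isOpen_ball.mem_nhds (hsub hz))) (fun z hz => ?_) (convex_closedBall c r) hx hy
    have hzs : closedBall z (r / 2) ⊆ ball c (2 * r) := by
      intro w hw
      rw [mem_closedBall] at hw hz
      rw [mem_ball]
      linarith [dist_triangle w z c]
    exact Complex.norm_deriv_le_of_forall_mem_sphere_norm_le (half_pos hr)
      ((hF n).diffContOnCl_ball hzs) fun w hw => hB n w (hzs (sphere_subset_closedBall hw))
  have hcs : CompactSpace (closedBall c r) := isCompact_iff_compactSpace.1 (isCompact_closedBall c r)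
  let G : ℕ → BoundedContinuousFunction (closedBall c r) ℂ := fun n =>
    BoundedContinuousFunction.mkOfCompact
      ⟨fun x => F n x, ((hF n).continuousOn.mono hsub).domRestrict⟩
  have hcomp : IsCompact (closure (range G)) := by
    refine BoundedContinuousFunction.arzela_ascoli (closedBall (0 : ℂ) B)
      (isCompact_closedBall _ _) _ ?_ ?_
    · rintro _ x ⟨n, rfl⟩
      rw [mem_closedBall_zero_iff]
      exact hB n x (hsub x.2)
    · refine Metric.equicontinuous_of_continuity_modulus (fun t => B / (r / 2) * t) ?_ _ ?_
      · have : Continuous fun t : ℝ => B / (r / 2) * t := by fun_prop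
        simpa using this.tendsto 0
      · rintro x y ⟨_, n, rfl⟩
        have := hlip n y y.2 x x.2
        rw [← dist_eq_norm, ← dist_eq_norm] at this
        exact this
  obtain ⟨g, -, φ, hφ, hg⟩ := hcomp.tendsto_subseq fun n => subset_closure (mem_range_self n)
  classical
  refine ⟨φ, hφ, fun z => if hz : z ∈ closedBall c r then g ⟨z, hz⟩ else 0, ?_⟩
  rw [tendstoUniformlyOn_iff_tendstoUniformly_comp_coe]
  have := BoundedContinuousFunction.tendsto_iff_tendstoUniformly.1 hg
  have heq : (fun z => if hz : z ∈ closedBall c r then g ⟨z, hz⟩ else 0) ∘ Subtype.val = ⇑g :=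
    funext fun x => dif_pos x.2
  rw [heq]
  exact this

/-! ### Entire functions of exponential type -/

/-- `f` is an entire function of exponential type. -/
def ExpType (f : ℂ → ℂ) : Prop :=
  Differentiable ℂ f ∧ ∃ C : ℝ, 0 ≤ C ∧ ∀ z, ‖f z‖ ≤ Real.exp (C * (1 + ‖z‖))

theorem ExpType.const (a : ℂ) : ExpType fun _ => a := by
  refine ⟨by fun_prop, ‖a‖, norm_nonneg a, fun z => ?_⟩
  have h1 := Real.add_one_le_exp (‖a‖ * (1 + ‖z‖))
  nlinarith [norm_nonneg a, norm_nonneg z, mul_nonneg (norm_nonneg a) (norm_nonneg z)]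

theorem ExpType.id : ExpType fun z => z := by
  refine ⟨by fun_prop, 1, zero_le_one, fun z => ?_⟩
  have h1 := Real.add_one_le_exp (1 * (1 + ‖z‖))
  linarith [norm_nonneg z]

theorem ExpType.mul {f g : ℂ → ℂ} (hf : ExpType f) (hg : ExpType g) :
    ExpType fun z => f z * g z := by
  obtain ⟨hfd, A, hA, hfA⟩ := hf
  obtain ⟨hgd, B, hB, hgB⟩ := hg
  refine ⟨hfd.mul hgd, A + B, add_nonneg hA hB, fun z => ?_⟩
  rw [norm_mul, add_mul, Real.exp_add]
  exact mul_le_mul (hfA z) (hgB z) (norm_nonneg _) (Real.exp_pos _).le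

theorem ExpType.add {f g : ℂ → ℂ} (hf : ExpType f) (hg : ExpType g) :
    ExpType fun z => f z + g z := by
  obtain ⟨hfd, A, hA, hfA⟩ := hf
  obtain ⟨hgd, B, hB, hgB⟩ := hg
  refine ⟨hfd.add hgd, A + B + 1, by positivity, fun z => ?_⟩
  have hz := norm_nonneg z
  have h1 : Real.exp (A * (1 + ‖z‖)) ≤ Real.exp ((A + B) * (1 + ‖z‖)) := by gcongr; linarith
  have h2 : Real.exp (B * (1 + ‖z‖)) ≤ Real.exp ((A + B) * (1 + ‖z‖)) := by gcongr; linarith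
  have h3 : 2 ≤ Real.exp (1 + ‖z‖) := by linarith [Real.add_one_le_exp (1 + ‖z‖)]
  rw [add_mul (A + B), Real.exp_add, one_mul]
  calc _ ≤ ‖f z‖ + ‖g z‖ := norm_add_le _ _
    _ ≤ Real.exp ((A + B) * (1 + ‖z‖)) * 2 := by linarith [hfA z, hgB z]
    _ ≤ _ := by gcongr

theorem ExpType.pow {f : ℂ → ℂ} (hf : ExpType f) (n : ℕ) : ExpType fun z => f z ^ n := by
  induction n with
  | zero => simpa using ExpType.const 1
  | succ n ih => simpa only [pow_succ] using ih.mul hf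

theorem ExpType.prod {ι : Type*} (s : Finset ι) {f : ι → ℂ → ℂ} (hf : ∀ i ∈ s, ExpType (f i)) :
    ExpType fun z => ∏ i ∈ s, f i z := by
  classical
  induction s using Finset.induction_on with
  | empty => simpa using ExpType.const 1
  | insert a s ha ih =>
    simp only [Finset.prod_insert ha]
    exact (hf a (Finset.mem_insert_self a s)).mul
      (ih fun i hi => hf i (Finset.mem_insert_of_mem hi))

theorem ExpType.deriv {f : ℂ → ℂ} (hf : ExpType f) : ExpType (deriv f) := by
  obtain ⟨hfd, A, hA, hfA⟩ := hf
  refine ⟨hfd.deriv, 2 * A, by positivity, fun z => ?_⟩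
  have := Complex.norm_deriv_le_of_forall_mem_sphere_norm_le (c := z) one_pos
    hfd.diffContOnCl (C := Real.exp (A * (2 + ‖z‖))) fun w hw => (hfA w).trans <| by
      rw [mem_sphere, dist_eq_norm] at hw
      have := norm_sub_norm_le w z
      refine Real.exp_le_exp.2 (mul_le_mul_of_nonneg_left ?_ hA)
      linarith
  rw [div_one] at this
  refine this.trans (Real.exp_le_exp.2 ?_)
  nlinarith [norm_nonneg z, mul_nonneg hA (norm_nonneg z)]

theorem ExpType.iteratedDeriv {f : ℂ → ℂ} (hf : ExpType f) (n : ℕ) :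
    ExpType (iteratedDeriv n f) := by
  induction n with
  | zero => simpa using hf
  | succ n ih => rw [iteratedDeriv_succ]; exact ih.deriv

/-- An entire function whose real part grows at most linearly is affine. -/
theorem exists_eq_affine_of_re_le {h : ℂ → ℂ} (hh : Differentiable ℂ h) {A : ℝ} (hA : 0 ≤ A)
    (hre : ∀ z, (h z).re ≤ A * (1 + ‖z‖)) : ∃ a b : ℂ, ∀ z, h z = a * z + b := by
  have hgrow : ∀ z, ‖h z‖ ≤ 2 * (A + 1) * (1 + 2 * (1 + ‖z‖)) + 3 * ‖h 0‖ := by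
    intro z
    have hz := norm_nonneg z
    have h1 := Complex.borelCaratheodory (M := (A + 1) * (1 + 2 * (1 + ‖z‖))) (z := z)
      (R := 2 * (1 + ‖z‖)) (f := h) (by positivity) hh.differentiableOn
      (fun w hw => by
        rw [mem_ball_zero_iff] at hw
        refine (hre w).trans ?_
        have := norm_nonneg w
        gcongr
        linarith) (by positivity) (by rw [mem_ball_zero_iff]; linarith)
    have hpos : 0 < 2 * (1 + ‖z‖) - ‖z‖ := by linarith
    refine h1.trans (add_le_add ?_ ?_)
    · rw [div_le_iff₀ hpos]
      have : 0 ≤ 2 * ((A + 1) * (1 + 2 * (1 + ‖z‖))) := by positivity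
      nlinarith
    · rw [div_le_iff₀ hpos]
      nlinarith [norm_nonneg (h 0)]
  have h2 : ∀ c, iteratedDeriv 2 h c = 0 := by
    intro c
    rw [← norm_le_zero_iff]
    set K := 2 * (A + 1) * (1 + 2 * (1 + ‖c‖)) + 3 * ‖h 0‖ with hK
    have hb : ∀ R : ℝ, 0 < R → ‖iteratedDeriv 2 h c‖ ≤ 2 * (K * R⁻¹ ^ 2 + 4 * (A + 1) * R⁻¹) := by
      intro R hR
      have := Complex.norm_iteratedDeriv_le_of_forall_mem_sphere_norm_le (c := c) 2 hR
        hh.diffContOnCl (C := K + 4 * (A + 1) * R) fun w hw => (hgrow w).trans <| by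
          rw [mem_sphere, dist_eq_norm] at hw
          have h3 : ‖w‖ ≤ ‖c‖ + R := by linarith [norm_sub_norm_le w c]
          rw [hK]
          nlinarith
      refine this.trans (le_of_eq ?_)
      simp
      field_simp
    have hlim : Tendsto (fun R : ℝ => 2 * (K * R⁻¹ ^ 2 + 4 * (A + 1) * R⁻¹)) atTop (𝓝 0) := by
      have h0 := tendsto_inv_atTop_zero (𝕜 := ℝ)
      simpa using (((h0.pow 2).const_mul K).add (h0.const_mul (4 * (A + 1)))).const_mul 2
    exact ge_of_tendsto hlim ((eventually_gt_atTop 0).mono hb)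
  have hd : ∀ z, _root_.deriv h z = _root_.deriv h 0 := fun z =>
    is_const_of_deriv_eq_zero hh.deriv (fun c => by
      simpa [iteratedDeriv_succ] using h2 c) z 0
  refine ⟨_root_.deriv h 0, h 0, fun z => ?_⟩
  have := is_const_of_deriv_eq_zero (f := fun z => h z - _root_.deriv h 0 * z) (by fun_prop)
    (fun c => by
      have h3 : HasDerivAt (fun z => h z - _root_.deriv h 0 * z)
          (_root_.deriv h c - _root_.deriv h 0 * 1) c :=
        (hh c).hasDerivAt.sub ((hasDerivAt_id c).const_mul _)
      rw [h3.deriv, hd c]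
      ring) z 0
  simp only [mul_zero, sub_zero] at this
  rw [← this]
  ring

theorem ExpType.exists_eq_exp_affine {f : ℂ → ℂ} (hf : ExpType f) (h0 : ∀ z, f z ≠ 0) :
    ∃ a b : ℂ, ∀ z, f z = Complex.exp (a * z + b) := by
  obtain ⟨hfd, A, hA, hfA⟩ := hf
  obtain ⟨h, hh, he⟩ := exists_eq_exp hfd h0
  obtain ⟨a, b, hab⟩ := exists_eq_affine_of_re_le hh hA fun z => by
    have := hfA z
    rwa [he, Complex.norm_exp, Real.exp_le_exp] at this
  exact ⟨a, b, fun z => by rw [he, hab]⟩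

/-! ### From local to global extraction of convergent subsequences -/

/-- `‖F n‖ → ∞` locally uniformly on `U`. -/
def TendstoInftyOn {X : Type*} [TopologicalSpace X] (F : ℕ → X → ℂ) (L : Filter ℕ) (U : Set X) :
    Prop :=
  ∀ C : ℝ, ∀ x ∈ U, ∃ t ∈ 𝓝[U] x, ∀ᶠ n in L, ∀ y ∈ t, C ≤ ‖F n y‖

/-- `F n` converges locally uniformly on `U`, to a finite function or to `∞`. -/
def ConvergesOn {X : Type*} [TopologicalSpace X] (F : ℕ → X → ℂ) (L : Filter ℕ) (U : Set X) :
    Prop :=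
  (∃ g : X → ℂ, TendstoLocallyUniformlyOn F g L U) ∨ TendstoInftyOn F L U

section
variable {X : Type*} [TopologicalSpace X] {F : ℕ → X → ℂ} {U V : Set X}

theorem TendstoInftyOn.comp {L L' : Filter ℕ} (h : TendstoInftyOn F L U) {x : ℕ → ℕ}
    (hx : Tendsto x L' L) : TendstoInftyOn (fun n => F (x n)) L' U := fun C y hy =>
  let ⟨t, ht, H⟩ := h C y hy
  ⟨t, ht, hx.eventually H⟩

theorem TendstoInftyOn.tendsto_norm {L : Filter ℕ} (h : TendstoInftyOn F L U) {x : X}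
    (hx : x ∈ U) : Tendsto (fun n => ‖F n x‖) L atTop := by
  refine tendsto_atTop.2 fun C => ?_
  obtain ⟨t, ht, H⟩ := h C x hx
  exact H.mono fun n hn => hn x (mem_of_mem_nhdsWithin hx ht)

theorem TendstoInftyOn.eventually_forall_le {L : Filter ℕ} (h : TendstoInftyOn F L U) {K : Set X}
    (hK : IsCompact K) (hKU : K ⊆ U) (C : ℝ) : ∀ᶠ n in L, ∀ y ∈ K, C ≤ ‖F n y‖ := by
  refine hK.induction_on (by simp) (fun s t hst ht => ht.mono fun n hn y hy => hn y (hst hy))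
    (fun s t hs ht => by
      filter_upwards [hs, ht] with n h1 h2 y hy using hy.elim (h1 y) (h2 y)) fun x hx => ?_
  obtain ⟨t, ht, H⟩ := h C x (hKU hx)
  exact ⟨t, nhdsWithin_mono _ hKU ht, H⟩

theorem tendstoLocallyUniformlyOn_comp {L L' : Filter ℕ} {g : X → ℂ}
    (h : TendstoLocallyUniformlyOn F g L U) {x : ℕ → ℕ} (hx : Tendsto x L' L) :
    TendstoLocallyUniformlyOn (fun n => F (x n)) g L' U := fun u hu y hy =>
  let ⟨t, ht, H⟩ := h u hu y hy
  ⟨t, ht, hx.eventually H⟩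

theorem ConvergesOn.comp {L L' : Filter ℕ} (h : ConvergesOn F L U) {x : ℕ → ℕ}
    (hx : Tendsto x L' L) : ConvergesOn (fun n => F (x n)) L' U :=
  h.imp (fun ⟨g, hg⟩ => ⟨g, tendstoLocallyUniformlyOn_comp hg hx⟩) fun h => h.comp hx

/-- If subsequences converging on members of a countable cover can be extracted one after the
other, there is one subsequence converging on all of them. The diagonal subsequence is found as a
sequence tending to the infimum of the filters given by the successive subsequences. -/
theorem exists_subseq_forall_convergesOn {U : ℕ → Set X}
    (h : ∀ i, ∀ φ : ℕ → ℕ, StrictMono φ → ∃ ψ : ℕ → ℕ, StrictMono ψ ∧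
      ConvergesOn (fun n => F (φ (ψ n))) atTop (U i)) :
    ∃ φ : ℕ → ℕ, StrictMono φ ∧ ∀ i, ConvergesOn (fun n => F (φ n)) atTop (U i) := by
  choose ψ hψ hψc using h
  let Φ : ℕ → {φ : ℕ → ℕ // StrictMono φ} := fun n => n.rec ⟨id, strictMono_id⟩
    fun i φ => ⟨φ.1 ∘ ψ i φ.1 φ.2, φ.2.comp (hψ i φ.1 φ.2)⟩
  let L : ℕ → Filter ℕ := fun i => map (Φ i).1 atTop
  have hL : Antitone L := antitone_nat_of_succ_le fun i => by
    change map ((Φ i).1 ∘ ψ i _ _) atTop ≤ map (Φ i).1 atTop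
    rw [← map_map]
    exact map_mono (hψ i _ _).tendsto_atTop
  have hconv : ∀ i, ConvergesOn F (L (i + 1)) (U i) := fun i =>
    hψc i (Φ i).1 (Φ i).2
  have hne : (⨅ i, L i).NeBot := iInf_neBot_of_directed
    (hL.directed_ge) fun i => map_neBot
  obtain ⟨x, hx⟩ := exists_seq_tendsto (⨅ i, L i)
  have hxL : ∀ i, Tendsto x atTop (L i) := fun i => hx.mono_right (iInf_le _ i)
  have hxt : Tendsto x atTop atTop := by simpa [L, Φ] using hxL 0
  obtain ⟨φ, hφ, hxφ⟩ := strictMono_subseq_of_tendsto_atTop hxt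
  exact ⟨x ∘ φ, hxφ, fun i => (hconv i).comp ((hxL (i + 1)).comp hφ.tendsto_atTop)⟩

theorem ConvergesOn.of_forall_exists_nhds {L : Filter ℕ} [L.NeBot] {D : Set X}
    (hD : IsPreconnected D) (h : ∀ x ∈ D, ∃ U, IsOpen U ∧ x ∈ U ∧ ConvergesOn F L U) :
    ConvergesOn F L D := by
  by_cases hA : ∀ x ∈ D, ∃ U, IsOpen U ∧ x ∈ U ∧ ∃ g, TendstoLocallyUniformlyOn F g L U
  · left
    choose! U hU hxU g hg using hA
    refine ⟨fun x => g x x, fun u hu x hx => ?_⟩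
    obtain ⟨t, ht, H⟩ := hg x hx u hu x (hxU x hx)
    refine ⟨t ∩ U x ∩ D, ?_, H.mono fun n hn y hy => ?_⟩
    · refine inter_mem (inter_mem ?_ (mem_nhdsWithin_of_mem_nhds ((hU x hx).mem_nhds (hxU x hx))))
        self_mem_nhdsWithin
      exact mem_nhdsWithin_of_mem_nhds ((hU x hx).nhdsWithin_eq (hxU x hx) ▸ ht)
    · have : g y y = g x y := tendsto_nhds_unique ((hg y hy.2).tendsto_at (hxU y hy.2))
        ((hg x hx).tendsto_at hy.1.2)
      change (g y y, F n y) ∈ u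
      rw [this]
      exact hn y hy.1.1
  by_cases hB : ∀ x ∈ D, ∃ U, IsOpen U ∧ x ∈ U ∧ TendstoInftyOn F L U
  · right
    intro C x hx
    obtain ⟨U, hU, hxU, H⟩ := hB x hx
    obtain ⟨t, ht, H⟩ := H C x hxU
    exact ⟨t, mem_nhdsWithin_of_mem_nhds (hU.nhdsWithin_eq hxU ▸ ht), H⟩
  exfalso
  push Not at hA hB
  obtain ⟨a, ha, hA⟩ := hA
  obtain ⟨b, hb, hB⟩ := hB
  obtain ⟨x, -, ⟨U, ⟨hU, g, hg⟩, hxU⟩, ⟨V, ⟨hV, hinf⟩, hxV⟩⟩ := hD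
    (⋃₀ {U | IsOpen U ∧ ∃ g, TendstoLocallyUniformlyOn F g L U})
    (⋃₀ {U | IsOpen U ∧ TendstoInftyOn F L U})
    (isOpen_sUnion fun U hU => hU.1) (isOpen_sUnion fun U hU => hU.1)
    (fun x hx => by
      obtain ⟨U, hU, hxU, h | h⟩ := h x hx
      · exact Or.inl ⟨U, ⟨hU, h⟩, hxU⟩
      · exact Or.inr ⟨U, ⟨hU, h⟩, hxU⟩)
    (by
      obtain ⟨U, hU, hxU, h | h⟩ := h b hb
      · exact ⟨b, hb, U, ⟨hU, h⟩, hxU⟩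
      · exact absurd h (hB U hU hxU))
    (by
      obtain ⟨U, hU, hxU, h | h⟩ := h a ha
      · obtain ⟨g, hg⟩ := h
        exact absurd hg (hA U hU hxU g)
      · exact ⟨a, ha, U, ⟨hU, h⟩, hxU⟩)
  exact not_tendsto_nhds_of_tendsto_atTop (hinf.tendsto_norm hxV) _ (hg.tendsto_at hxU).norm

/-- A sequence that is normal near every point of a preconnected set `D` is normal on `D`. -/
theorem exists_subseq_convergesOn {D : Set X} (hDL : IsLindelof D) (hD : IsPreconnected D)
    (h : ∀ x ∈ D, ∃ U, IsOpen U ∧ x ∈ U ∧ ∀ φ : ℕ → ℕ, StrictMono φ → ∃ ψ : ℕ → ℕ, StrictMono ψ ∧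
      ConvergesOn (fun n => F (φ (ψ n))) atTop U) :
    ∃ φ : ℕ → ℕ, StrictMono φ ∧ ConvergesOn (fun n => F (φ n)) atTop D := by
  rcases D.eq_empty_or_nonempty with rfl | hne
  · exact ⟨id, strictMono_id, Or.inr fun C x hx => hx.elim⟩
  choose! U hU hxU hc using h
  obtain ⟨t, htc, htD, ht⟩ := hDL.elim_nhds_subcover U
    fun x hx => (hU x hx).mem_nhds (hxU x hx)
  have htne : t.Nonempty := by
    obtain ⟨x, hx⟩ := hne
    obtain ⟨y, hy, -⟩ := mem_iUnion₂.1 (ht hx)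
    exact ⟨y, hy⟩
  obtain ⟨e, rfl⟩ := htc.exists_eq_range htne
  obtain ⟨φ, hφ, hconv⟩ := exists_subseq_forall_convergesOn (U := fun i => U (e i))
    fun i => hc (e i) (htD _ (mem_range_self i))
  refine ⟨φ, hφ, ConvergesOn.of_forall_exists_nhds hD fun x hx => ?_⟩
  obtain ⟨_, ⟨i, rfl⟩, hi⟩ := mem_iUnion₂.1 (ht hx)
  exact ⟨U (e i), hU _ (htD _ (mem_range_self i)), hi, hconv i⟩

end

/-! ### Differential monomials -/

/-- The derivation `m * d/dz`. The coefficient `m = 1` gives the derivative in the plane, and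
`m = - w ^ 2` gives `d/dz` in the coordinate `w = 1 / z` at `∞`. -/
noncomputable def derivation (m f : ℂ → ℂ) (z : ℂ) : ℂ := m z * deriv f z

/-- The differential monomial `∏ i ≤ k, (δ^i f) ^ q i` for the derivation `δ = m * d/dz`. -/
noncomputable def diffMonomial (m : ℂ → ℂ) (k : ℕ) (q : ℕ → ℕ) (f : ℂ → ℂ) (z : ℂ) : ℂ :=
  ∏ i ∈ Finset.range (k + 1), ((derivation m)^[i] f z) ^ q i

theorem derivation_one_iterate (f : ℂ → ℂ) (i : ℕ) :
    (derivation (fun _ => 1))^[i] f = iteratedDeriv i f := by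
  have : derivation (fun _ => 1) = deriv := by
    ext f z
    simp [derivation]
  rw [this, iteratedDeriv_eq_iterate]

theorem derivation_iterate_congr {m f g : ℂ → ℂ} {z : ℂ} (h : f =ᶠ[𝓝 z] g) (i : ℕ) :
    (derivation m)^[i] f =ᶠ[𝓝 z] (derivation m)^[i] g := by
  induction i with
  | zero => exact h
  | succ i ih =>
    rw [Function.iterate_succ_apply', Function.iterate_succ_apply']
    filter_upwards [ih.deriv] with w hw
    rw [derivation, derivation, hw]

theorem diffMonomial_congr {m f g : ℂ → ℂ} {z : ℂ} (h : f =ᶠ[𝓝 z] g) (k : ℕ) (q : ℕ → ℕ) :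
    diffMonomial m k q f z = diffMonomial m k q g z :=
  Finset.prod_congr rfl fun i _ => by rw [(derivation_iterate_congr h i).self_of_nhds]

theorem differentiableOn_derivation_iterate {m f : ℂ → ℂ} (hm : Differentiable ℂ m) {U : Set ℂ}
    (hU : IsOpen U) (hf : DifferentiableOn ℂ f U) (i : ℕ) :
    DifferentiableOn ℂ ((derivation m)^[i] f) U := by
  induction i with
  | zero => exact hf
  | succ i ih =>
    rw [Function.iterate_succ_apply']
    exact hm.differentiableOn.mul (ih.deriv hU)

theorem ExpType.derivation_iterate {m f : ℂ → ℂ} (hm : ExpType m) (hf : ExpType f) (i : ℕ) :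
    ExpType ((derivation m)^[i] f) := by
  induction i with
  | zero => exact hf
  | succ i ih =>
    rw [Function.iterate_succ_apply']
    exact hm.mul ih.deriv

theorem ExpType.diffMonomial {m f : ℂ → ℂ} (hm : ExpType m) (hf : ExpType f) (k : ℕ) (q : ℕ → ℕ) :
    ExpType (diffMonomial m k q f) :=
  ExpType.prod _ fun i _ => (hm.derivation_iterate hf i).pow _

section
variable {ι : Type*} {L : Filter ι} {F : ι → ℂ → ℂ} {f : ℂ → ℂ} {U : Set ℂ}

theorem tendstoLocallyUniformlyOn_const_seq (f : ℂ → ℂ) :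
    TendstoLocallyUniformlyOn (fun _ : ι => f) f L U := fun _ hu _ _ =>
  ⟨univ, univ_mem, Eventually.of_forall fun _ _ _ => refl_mem_uniformity hu⟩

theorem tendstoLocallyUniformlyOn_derivation_iterate [L.NeBot] {m : ℂ → ℂ}
    (hm : Differentiable ℂ m) (hU : IsOpen U) (hF : ∀ᶠ n in L, DifferentiableOn ℂ (F n) U)
    (h : TendstoLocallyUniformlyOn F f L U) (i : ℕ) :
    TendstoLocallyUniformlyOn (fun n => (derivation m)^[i] (F n)) ((derivation m)^[i] f) L U := by
  have hfd := h.differentiableOn hF hU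
  induction i with
  | zero => exact h
  | succ i ih =>
    simp only [Function.iterate_succ_apply']
    exact (tendstoLocallyUniformlyOn_const_seq m).mul₀
      (ih.deriv (hF.mono fun n hn => differentiableOn_derivation_iterate hm hU hn i) hU)
      hm.continuous.continuousOn
      ((differentiableOn_derivation_iterate hm hU hfd i).deriv hU).continuousOn

theorem tendstoLocallyUniformlyOn_prod_pow (s : Finset ℕ) (q : ℕ → ℕ) {F : ℕ → ι → ℂ → ℂ}
    {f : ℕ → ℂ → ℂ} (h : ∀ i ∈ s, TendstoLocallyUniformlyOn (F i) (f i) L U)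
    (hf : ∀ i ∈ s, ContinuousOn (f i) U) :
    TendstoLocallyUniformlyOn (fun n z => ∏ i ∈ s, F i n z ^ q i) (fun z => ∏ i ∈ s, f i z ^ q i)
      L U := by
  have hpow : ∀ i ∈ s, ∀ j : ℕ,
      TendstoLocallyUniformlyOn (fun n z => F i n z ^ j) (fun z => f i z ^ j) L U := by
    intro i hi j
    induction j with
    | zero => simpa using tendstoLocallyUniformlyOn_const_seq (fun _ => 1)
    | succ j ih =>
      simp only [pow_succ]
      exact ih.fun_mul₀ (h i hi) ((hf i hi).pow j) (hf i hi)
  induction s using Finset.induction_on with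
  | empty => simpa using tendstoLocallyUniformlyOn_const_seq (fun _ => 1)
  | insert a s ha ih =>
    simp only [Finset.prod_insert ha]
    refine (hpow a (Finset.mem_insert_self a s) (q a)).fun_mul₀
      (ih (fun i hi => h i (Finset.mem_insert_of_mem hi))
        (fun i hi => hf i (Finset.mem_insert_of_mem hi))
        fun i hi => hpow i (Finset.mem_insert_of_mem hi))
      ((hf a (Finset.mem_insert_self a s)).pow _)
      (continuousOn_finsetProd _ fun i hi => (hf i (Finset.mem_insert_of_mem hi)).pow _)

theorem tendstoLocallyUniformlyOn_diffMonomial [L.NeBot] {m : ℂ → ℂ} (hm : Differentiable ℂ m)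
    (hU : IsOpen U) (hF : ∀ᶠ n in L, DifferentiableOn ℂ (F n) U)
    (h : TendstoLocallyUniformlyOn F f L U) (k : ℕ) (q : ℕ → ℕ) :
    TendstoLocallyUniformlyOn (fun n => diffMonomial m k q (F n)) (diffMonomial m k q f) L U :=
  tendstoLocallyUniformlyOn_prod_pow _ q
    (fun i _ => tendstoLocallyUniformlyOn_derivation_iterate hm hU hF h i)
    fun i _ => (differentiableOn_derivation_iterate hm hU
      (h.differentiableOn hF hU) i).continuousOn

theorem differentiableOn_diffMonomial {m : ℂ → ℂ} (hm : Differentiable ℂ m)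
    (hU : IsOpen U) (hf : DifferentiableOn ℂ f U) (k : ℕ) (q : ℕ → ℕ) :
    DifferentiableOn ℂ (diffMonomial m k q f) U :=
  DifferentiableOn.fun_finsetProd fun i _ =>
    (differentiableOn_derivation_iterate hm hU hf i).pow _

end

/-- By Hurwitz's theorem a limit of functions omitting the value `1` omits it or is constant. -/
theorem diffMonomial_ne_one_or_eq_one {m : ℂ → ℂ} (hm : Differentiable ℂ m) {k : ℕ} {q : ℕ → ℕ}
    {L : Filter ℕ} [L.NeBot] {F : ℕ → ℂ → ℂ} {f : ℂ → ℂ}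
    (hF : ∀ R : ℝ, ∀ᶠ n in L, DifferentiableOn ℂ (F n) (ball 0 R))
    (hne : ∀ R : ℝ, ∀ᶠ n in L, ∀ z ∈ ball 0 R, diffMonomial m k q (F n) z ≠ 1)
    (h : TendstoLocallyUniformlyOn F f L univ) :
    (∀ z, diffMonomial m k q f z ≠ 1) ∨ ∀ z, diffMonomial m k q f z = 1 := by
  by_contra! hcon
  obtain ⟨⟨z₀, hz₀⟩, z₁, hz₁⟩ := hcon
  set R := ‖z₀‖ + ‖z₁‖ + 1
  have hz₀R : z₀ ∈ ball (0 : ℂ) R := by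
    rw [mem_ball_zero_iff]; linarith [norm_nonneg z₁]
  have hz₁R : z₁ ∈ ball (0 : ℂ) R := by
    rw [mem_ball_zero_iff]; linarith [norm_nonneg z₀]
  have hlim := tendstoLocallyUniformlyOn_diffMonomial hm isOpen_ball (hF R)
    (h.mono (subset_univ (ball 0 R))) k q
  have hFd : ∀ᶠ n in L, DifferentiableOn ℂ (fun z => diffMonomial m k q (F n) z - 1)
      (ball 0 R) := (hF R).mono fun n hn =>
    (differentiableOn_diffMonomial hm isOpen_ball hn k q).sub_const 1
  have hlim' : TendstoLocallyUniformlyOn (fun n z => diffMonomial m k q (F n) z - 1)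
      (fun z => diffMonomial m k q f z - 1) L (ball 0 R) := by
    simp only [sub_eq_add_neg]
    exact (UniformContinuous.comp_tendstoLocallyUniformlyOn
      (g := fun x : ℂ => x + -1) (uniformContinuous_id.add_const (-1)) hlim)
  have hfd := hlim'.differentiableOn hFd isOpen_ball
  have hnz : ¬ ∀ᶠ z in 𝓝 z₀, diffMonomial m k q f z - 1 = 0 := by
    intro hev
    have := (hfd.analyticOnNhd isOpen_ball).eqOn_zero_of_preconnected_of_eventuallyEq_zero
      (convex_ball _ _).isPreconnected hz₀R hev hz₁R
    exact hz₁ (sub_eq_zero.1 this)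
  obtain ⟨r, hr, hsub⟩ := Metric.isOpen_iff.1 isOpen_ball z₀ hz₀R
  obtain ⟨n, ⟨z, hz, hz0⟩, hn⟩ := ((eventually_exists_zero isOpen_ball hFd hlim' hz₀R
    (by rw [hz₀, sub_self]) hnz hr).and (hne R)).exists
  exact hn z (hsub hz) (sub_eq_zero.1 hz0)

theorem exists_derivation_iterate_eq_zero {m f : ℂ → ℂ} (hm : Differentiable ℂ m)
    (hf : Differentiable ℂ f) {k : ℕ} {q : ℕ → ℕ} (h : ∀ z, diffMonomial m k q f z = 0) :
    ∃ i ≤ k, ∀ z, (derivation m)^[i] f z = 0 := by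
  by_contra! hcon
  have hev : ∀ i ∈ Finset.range (k + 1), ∀ᶠ z in 𝓝[≠] (0 : ℂ), (derivation m)^[i] f z ≠ 0 := by
    intro i hi
    have hd : Differentiable ℂ ((derivation m)^[i] f) := differentiableOn_univ.1
      (differentiableOn_derivation_iterate hm isOpen_univ hf.differentiableOn i)
    refine (hd.analyticAt 0).eventually_eq_zero_or_eventually_ne_zero.resolve_left fun hz => ?_
    obtain ⟨z, hz'⟩ := hcon i (Nat.lt_succ_iff.1 (Finset.mem_range.1 hi))
    exact hz' ((hd.differentiableOn.analyticOnNhd isOpen_univ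
      ).eqOn_zero_of_preconnected_of_eventuallyEq_zero isPreconnected_univ (mem_univ 0) hz
      (mem_univ z))
  obtain ⟨z, hz⟩ := ((Finset.eventually_all _).2 hev).exists
  exact Finset.prod_ne_zero_iff.2 (fun i hi => pow_ne_zero _ (hz i hi)) (h z)

theorem diffMonomial_eq_zero_of_eq_zero {m : ℂ → ℂ} {k : ℕ} {q : ℕ → ℕ} {f : ℂ → ℂ} {z : ℂ} {i : ℕ}
    (hi : i ≤ k) (hq : 1 ≤ q i) (hz : (derivation m)^[i] f z = 0) :
    diffMonomial m k q f z = 0 :=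
  Finset.prod_eq_zero (Finset.mem_range.2 (Nat.lt_succ_of_le hi))
    (by rw [hz, zero_pow (by omega)])

/-! ### Entire functions of exponential type and differential monomials in the plane -/

theorem iteratedDeriv_exp_affine (a b : ℂ) (i : ℕ) (z : ℂ) :
    iteratedDeriv i (fun z => Complex.exp (a * z + b)) z = a ^ i * Complex.exp (a * z + b) := by
  have : (fun z => Complex.exp (a * z + b)) = fun z => Complex.exp b * Complex.exp (a * z) := by
    ext z; rw [← Complex.exp_add, add_comm]
  rw [this, iteratedDeriv_const_mul_field, iteratedDeriv_cexp_const_mul, Complex.exp_add]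
  ring

theorem exists_diffMonomial_exp_eq {a b : ℂ} (ha : a ≠ 0) {k : ℕ} {q : ℕ → ℕ} (hq : 1 ≤ q 0)
    {c : ℂ} (hc : c ≠ 0) :
    ∃ z, diffMonomial (fun _ => 1) k q (fun z => Complex.exp (a * z + b)) z = c := by
  set Q := ∑ i ∈ Finset.range (k + 1), q i
  have hQ : (Q : ℂ) ≠ 0 := by
    have : 1 ≤ Q := hq.trans
      (Finset.single_le_sum (f := q) (fun _ _ => Nat.zero_le _) (Finset.mem_range.2 k.succ_pos))
    exact_mod_cast (by omega : Q ≠ 0)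
  set A := ∏ i ∈ Finset.range (k + 1), (a ^ i) ^ q i
  have hA : A ≠ 0 := Finset.prod_ne_zero_iff.2 fun i _ => pow_ne_zero _ (pow_ne_zero _ ha)
  refine ⟨(Complex.log (c / A) / Q - b) / a, ?_⟩
  rw [diffMonomial]
  simp only [derivation_one_iterate, iteratedDeriv_exp_affine, mul_pow, Finset.prod_mul_distrib,
    Finset.prod_pow_eq_pow_sum]
  rw [← Complex.exp_nat_mul, mul_div_cancel₀ _ ha, sub_add_cancel, mul_div_cancel₀ _ hQ,
    Complex.exp_log (div_ne_zero hc hA), mul_div_cancel₀ _ hA]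

/-- A Picard type theorem: for a nonconstant entire function `g` of exponential type, the
differential monomial takes the value `1`, unless it vanishes identically.
If `M` omits `1`, then `M = 1 + exp (a z + b)`, which has no multiple zeros unless `a = 0`, while
the zeros of `g` are multiple zeros of `M`. And if `g` has no zeros, it is an exponential. -/
theorem ExpType.diffMonomial_eq_zero {g : ℂ → ℂ} (hg : ExpType g) (hnc : ∃ z, _root_.deriv g z ≠ 0)
    {k : ℕ} {q : ℕ → ℕ} (hq : 2 ≤ q 0)
    (h : (∀ z, SphereNormal.diffMonomial (fun _ => 1) k q g z ≠ 1) ∨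
      ∀ z, SphereNormal.diffMonomial (fun _ => 1) k q g z = 1) :
    (∀ z, SphereNormal.diffMonomial (fun _ => 1) k q g z = 0) ∧ ∃ z, g z = 0 := by
  set M := SphereNormal.diffMonomial (fun _ => 1) k q g with hM
  have hz : ∃ z, g z = 0 := by
    by_contra! h0
    obtain ⟨a, b, hab⟩ := hg.exists_eq_exp_affine h0
    obtain rfl : g = fun z => Complex.exp (a * z + b) := funext hab
    have ha : a ≠ 0 := by
      rintro rfl
      obtain ⟨z, hz⟩ := hnc
      simp at hz
    obtain ⟨z₁, h₁⟩ := exists_diffMonomial_exp_eq (b := b) ha (k := k) (by omega : 1 ≤ q 0)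
      one_ne_zero
    obtain ⟨z₂, h₂⟩ := exists_diffMonomial_exp_eq (b := b) ha (k := k) (by omega : 1 ≤ q 0)
      two_ne_zero
    rcases h with h | h
    · exact h z₁ h₁
    · have := (h z₂).symm.trans h₂
      norm_num at this
  refine ⟨?_, hz⟩
  obtain ⟨z₀, hz₀⟩ := hz
  have hMz₀ : M z₀ = 0 := diffMonomial_eq_zero_of_eq_zero (Nat.zero_le k) (by omega) hz₀
  have hne : ∀ z, M z ≠ 1 := h.resolve_right fun h => by
    have := h z₀
    rw [hMz₀] at this
    norm_num at this
  have hME : ExpType M := (ExpType.const 1).diffMonomial hg k q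
  obtain ⟨a, b, hab⟩ := (hME.add (ExpType.const (-1))).exists_eq_exp_affine fun z hz =>
    hne z (by rwa [← sub_eq_add_neg, sub_eq_zero] at hz)
  have hMab : M = fun z => Complex.exp (a * z + b) + 1 := by
    ext z
    rw [← hab z]
    ring
  have hfac : M = fun z => g z ^ 2 * (g z ^ (q 0 - 2) *
      ∏ i ∈ Finset.range k, ((derivation fun _ => 1)^[i + 1] g z) ^ q (i + 1)) := by
    ext z
    rw [hM, SphereNormal.diffMonomial, Finset.prod_range_succ', ← mul_assoc, ← pow_add,
      Nat.add_sub_cancel' hq, mul_comm]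
    rfl
  have hd0 : _root_.deriv M z₀ = 0 := by
    rw [hfac]
    have h1 : HasDerivAt (fun z => g z ^ 2) 0 z₀ := by
      simpa [hz₀] using (hg.1 z₀).hasDerivAt.fun_pow 2
    have h2 : DifferentiableAt ℂ (fun z => g z ^ (q 0 - 2) *
        ∏ i ∈ Finset.range k, ((derivation fun _ => 1)^[i + 1] g z) ^ q (i + 1)) z₀ :=
      ((hg.pow _).mul (ExpType.prod _ fun i _ =>
        ((ExpType.const 1).derivation_iterate hg _).pow _)).1 z₀
    have := (h1.fun_mul h2.hasDerivAt).deriv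
    rw [this, hz₀]
    ring
  have hd1 : HasDerivAt M (Complex.exp (a * z₀ + b) * (a * 1)) z₀ := by
    rw [hMab]
    exact ((((hasDerivAt_id z₀).const_mul a).add_const b).cexp).add_const 1
  have ha : a = 0 := by
    rw [hd1.deriv] at hd0
    simpa [Complex.exp_ne_zero] using hd0
  intro z
  rw [← hMz₀, hMab, ha]
  simp

/-! ### The scaling exponent and rescaling -/

/-- The exponent `α = (∑ i q_i) / (∑ q_i)`: the differential monomial is invariant under
`f ↦ s ^ (-α) f (c + s z)`. -/
noncomputable def scalingExponent (k : ℕ) (q : ℕ → ℕ) : ℝ :=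
  (∑ i ∈ Finset.range (k + 1), i * q i : ℕ) / (∑ i ∈ Finset.range (k + 1), q i : ℕ)

theorem sum_exponents_pos {k : ℕ} {q : ℕ → ℕ} (hq : 1 ≤ q 0) :
    0 < ∑ i ∈ Finset.range (k + 1), q i :=
  hq.trans (Finset.single_le_sum (f := q) (fun _ _ => Nat.zero_le _)
    (Finset.mem_range.2 k.succ_pos))

theorem scalingExponent_lt {k : ℕ} (hk : 1 ≤ k) {q : ℕ → ℕ} (hq : 1 ≤ q 0) :
    scalingExponent k q < k := by
  have hQ := sum_exponents_pos (k := k) hq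
  rw [scalingExponent, div_lt_iff₀ (by exact_mod_cast hQ)]
  norm_cast
  rw [Finset.mul_sum]
  refine Finset.sum_lt_sum (fun i hi => ?_) ⟨0, Finset.mem_range.2 k.succ_pos, ?_⟩
  · exact Nat.mul_le_mul_right _ (Nat.lt_succ_iff.1 (Finset.mem_range.1 hi))
  · rw [zero_mul]; exact Nat.mul_pos hk hq

theorem scalingExponent_pos {k : ℕ} (hk : 1 ≤ k) {q : ℕ → ℕ} (hq : 1 ≤ q 0) (hqk : 1 ≤ q k) :
    0 < scalingExponent k q := by
  have hQ := sum_exponents_pos (k := k) hq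
  refine div_pos ?_ (by exact_mod_cast hQ)
  norm_cast
  exact (Nat.mul_pos hk hqk).trans_le (Finset.single_le_sum (f := fun i => i * q i)
    (fun i _ => Nat.zero_le _) (Finset.mem_range.2 k.lt_succ_self))

theorem deriv_mul_comp_affine (a c s : ℂ) (f : ℂ → ℂ) (z : ℂ) :
    deriv (fun z => a * f (c + s * z)) z = a * s * deriv f (c + s * z) := by
  rw [deriv_const_mul_field]
  have := deriv_comp_mul_left s (fun z => f (c + z)) z
  rw [this, deriv_comp_const_add, smul_eq_mul, mul_assoc]

theorem derivation_iterate_comp_affine {m₁ m₂ : ℂ → ℂ} {c s τ : ℂ}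
    (hm : ∀ z, m₁ z * s = τ * m₂ (c + s * z)) (a : ℂ) (f : ℂ → ℂ) (i : ℕ) :
    (derivation m₁)^[i] (fun z => a * f (c + s * z)) =
      fun z => a * τ ^ i * (derivation m₂)^[i] f (c + s * z) := by
  induction i with
  | zero => simp
  | succ i ih =>
    ext z
    rw [Function.iterate_succ_apply', ih, derivation, deriv_mul_comp_affine,
      Function.iterate_succ_apply', derivation]
    linear_combination (a * τ ^ i * deriv ((derivation m₂)^[i] f) (c + s * z)) * hm z

theorem diffMonomial_comp_affine {m₁ m₂ : ℂ → ℂ} {c s : ℂ} {τ : ℝ} (hτ : 0 < τ)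
    (hm : ∀ z, m₁ z * s = τ * m₂ (c + s * z)) {k : ℕ} {q : ℕ → ℕ} (hq : 1 ≤ q 0) (f : ℂ → ℂ)
    (z : ℂ) :
    diffMonomial m₁ k q (fun z => (τ ^ (-scalingExponent k q) : ℝ) * f (c + s * z)) z =
      diffMonomial m₂ k q f (c + s * z) := by
  have hQ : ((∑ i ∈ Finset.range (k + 1), q i : ℕ) : ℝ) ≠ 0 := by
    exact_mod_cast (sum_exponents_pos (k := k) hq).ne'
  have hone : (τ ^ (-scalingExponent k q)) ^ (∑ i ∈ Finset.range (k + 1), q i) *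
      τ ^ (∑ i ∈ Finset.range (k + 1), i * q i) = 1 := by
    rw [← Real.rpow_natCast, ← Real.rpow_natCast, ← Real.rpow_mul hτ.le, ← Real.rpow_add hτ,
      scalingExponent, neg_mul, div_mul_cancel₀ _ hQ, neg_add_cancel, Real.rpow_zero]
  rw [diffMonomial]
  simp only [derivation_iterate_comp_affine hm, mul_pow, Finset.prod_mul_distrib,
    Finset.prod_pow_eq_pow_sum, ← pow_mul]
  rw [← Complex.ofReal_pow, ← Complex.ofReal_pow, ← Complex.ofReal_mul, hone, Complex.ofReal_one,
    one_mul, diffMonomial]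

/-- The conditions of the theorem on a function in a subset of the plane. That the zeros have
multiplicity at least `k` is expressed by the vanishing of the derivatives of order less than `k`. -/
structure Admissible (k : ℕ) (q : ℕ → ℕ) (f : ℂ → ℂ) (U : Set ℂ) : Prop where
  differentiableOn : DifferentiableOn ℂ f U
  zeros : ∀ z ∈ U, f z = 0 → ∀ j < k, iteratedDeriv j f z = 0
  ne_one : ∀ z ∈ U, diffMonomial (fun _ => 1) k q f z ≠ 1

theorem Admissible.mono {k : ℕ} {q : ℕ → ℕ} {f : ℂ → ℂ} {U V : Set ℂ} (h : Admissible k q f U)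
    (hVU : V ⊆ U) : Admissible k q f V :=
  ⟨h.1.mono hVU, fun z hz => h.2 z (hVU hz), fun z hz => h.3 z (hVU hz)⟩

theorem Admissible.comp_affine {k : ℕ} {q : ℕ → ℕ} (hq : 1 ≤ q 0) {f : ℂ → ℂ} {U V : Set ℂ}
    (h : Admissible k q f U) {s : ℝ} (hs : 0 < s) {c : ℂ} (hV : ∀ z ∈ V, c + s * z ∈ U) :
    Admissible k q (fun z => (s ^ (-scalingExponent k q) : ℝ) * f (c + s * z)) V := by
  have hm : ∀ _ : ℂ, (1 : ℂ) * s = s * 1 := fun _ => by ring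
  refine ⟨?_, fun z hz h0 j hj => ?_, fun z hz => ?_⟩
  · exact (h.1.comp (t := U) (f := fun z : ℂ => c + s * z) (by fun_prop) hV).const_mul _
  · have ha : ((s ^ (-scalingExponent k q) : ℝ) : ℂ) ≠ 0 := by
      exact_mod_cast (Real.rpow_pos_of_pos hs _).ne'
    rw [← derivation_one_iterate, derivation_iterate_comp_affine (m₂ := fun _ => 1) hm,
      derivation_one_iterate]
    exact mul_eq_zero_of_right _ (h.2 _ (hV z hz) ((mul_eq_zero.1 h0).resolve_left ha) j hj)
  · rw [diffMonomial_comp_affine (m₂ := fun _ => 1) hs hm hq]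
    exact h.3 _ (hV z hz)

/-! ### No limit functions -/

/-- A nonconstant entire function of exponential type is not a limit of admissible functions:
its differential monomial would vanish identically, so it would be a polynomial of degree less than
`k`, but its zeros have multiplicity at least `k`. -/
theorem not_tendstoLocallyUniformlyOn_of_admissible {k : ℕ} {q : ℕ → ℕ} (hq : 2 ≤ q 0)
    {F : ℕ → ℂ → ℂ} {g : ℂ → ℂ} {L : Filter ℕ} [L.NeBot]
    (hF : ∀ R : ℝ, ∀ᶠ n in L, Admissible k q (F n) (ball 0 R)) (hg : ExpType g)
    (hnc : ∃ z, deriv g z ≠ 0) : ¬ TendstoLocallyUniformlyOn F g L univ := by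
  intro h
  have hFd : ∀ R : ℝ, ∀ᶠ n in L, DifferentiableOn ℂ (F n) (ball 0 R) :=
    fun R => (hF R).mono fun n hn => hn.1
  have h1 : Differentiable ℂ (fun _ : ℂ => (1 : ℂ)) := by fun_prop
  obtain ⟨hM, z₀, hz₀⟩ := hg.diffMonomial_eq_zero hnc hq
    (diffMonomial_ne_one_or_eq_one h1 hFd (fun R => (hF R).mono fun n hn => hn.3) h)
  obtain ⟨i, hik, hi⟩ := exists_derivation_iterate_eq_zero h1 hg.1 hM
  rw [derivation_one_iterate] at hi
  have hnz : ¬ ∀ᶠ z in 𝓝 z₀, g z = 0 := by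
    intro hev
    obtain ⟨z, hz⟩ := hnc
    have heq : g = 0 := funext fun z =>
      (hg.1.differentiableOn.analyticOnNhd isOpen_univ).eqOn_zero_of_preconnected_of_eventuallyEq_zero
        isPreconnected_univ (mem_univ z₀) hev (mem_univ z)
    exact hz (by simp [heq])
  set R := ‖z₀‖ + 1
  have hz₀R : z₀ ∈ ball (0 : ℂ) R := by rw [mem_ball_zero_iff]; linarith
  have hR := h.mono (subset_univ (ball 0 R))
  -- the derivatives of order less than `k` vanish at `z₀`, since they do at nearby zeros of `F n`
  have hlow : ∀ j < k, iteratedDeriv j g z₀ = 0 := by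
    intro j hj
    rw [← norm_le_zero_iff]
    refine le_of_forall_pos_le_add fun ε hε => ?_
    have hcont : ContinuousAt (iteratedDeriv j g) z₀ := (hg.iteratedDeriv j).1.continuous.continuousAt
    have hconv := tendstoLocallyUniformlyOn_derivation_iterate h1 isOpen_ball (hFd R) hR j
    simp only [derivation_one_iterate] at hconv
    obtain ⟨t, ht, hclose⟩ := Metric.tendstoLocallyUniformlyOn_iff.1 hconv (ε / 2) (half_pos hε)
      z₀ hz₀R
    rw [isOpen_ball.nhdsWithin_eq hz₀R] at ht
    obtain ⟨r, hr, hsub⟩ := Metric.mem_nhds_iff.1 (inter_mem (inter_mem ht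
      (hcont (Metric.ball_mem_nhds _ (half_pos hε)))) (isOpen_ball.mem_nhds hz₀R))
    obtain ⟨n, ⟨⟨z, hz, hFz⟩, hn⟩, hcl⟩ :=
      ((eventually_exists_zero isOpen_ball (hFd R) hR hz₀R hz₀ hnz hr).and (hF R)).and hclose |>.exists
    have h2 := hcl z (hsub hz).1.1
    rw [hn.2 z (hsub hz).2 hFz j hj, dist_zero_right] at h2
    have h3 : dist (iteratedDeriv j g z) (iteratedDeriv j g z₀) < ε / 2 := (hsub hz).1.2
    rw [dist_comm, dist_eq_norm] at h3
    linarith [norm_sub_norm_le (iteratedDeriv j g z₀) (iteratedDeriv j g z)]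
  have hall : ∀ j, iteratedDeriv j g z₀ = 0 := by
    intro j
    rcases lt_or_ge j k with hj | hj
    · exact hlow j hj
    · obtain ⟨l, rfl⟩ := Nat.exists_eq_add_of_le (hik.trans hj)
      have hz : iteratedDeriv i g = fun _ => 0 := funext hi
      rw [add_comm, iteratedDeriv_eq_iterate, Function.iterate_add_apply, ← iteratedDeriv_eq_iterate,
        ← iteratedDeriv_eq_iterate, hz, iteratedDeriv_fun_const_zero]
  refine hnz (analyticOrderAt_eq_top.1 (ENat.eq_top_iff_forall_ge.2 fun n => ?_))
  exact (natCast_le_analyticOrderAt_iff_iteratedDeriv_eq_zero (hg.1.analyticAt z₀)).2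
    fun i _ => hall i

/-- Montel's theorem for a sequence that is bounded from some index on. -/
theorem exists_subseq_tendsto_of_eventually_bounded {F : ℕ → ℂ → ℂ} {c : ℂ} {r B : ℝ} (hr : 0 < r)
    (hF : ∀ᶠ n in atTop, DifferentiableOn ℂ (F n) (ball c (2 * r)))
    (hB : ∀ᶠ n in atTop, ∀ z ∈ ball c (2 * r), ‖F n z‖ ≤ B) :
    ∃ φ : ℕ → ℕ, StrictMono φ ∧ ∃ g : ℂ → ℂ,
      TendstoLocallyUniformlyOn (fun n => F (φ n)) g atTop (ball c r) := by
  obtain ⟨N, hN⟩ := eventually_atTop.1 (hF.and hB)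
  obtain ⟨φ, hφ, g, hg⟩ := exists_subseq_tendstoUniformlyOn (F := fun n => F (n + N)) hr
    (fun n => (hN (n + N) (by omega)).1) fun n => (hN (n + N) (by omega)).2
  exact ⟨fun n => φ n + N, fun a b hab => Nat.add_lt_add_right (hφ hab) N, g,
    hg.tendstoLocallyUniformlyOn.mono ball_subset_closedBall⟩

/-- Admissible functions on large discs centred at `0`, whose derivative is bounded on the level
set `‖g‖ = 1`, have small spherical derivative at `0`. -/
theorem exists_radius_norm_deriv_lt {k : ℕ} {q : ℕ → ℕ} (hq : 2 ≤ q 0) {C : ℝ} (hC : 0 ≤ C) :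
    ∃ R : ℝ, 0 < R ∧ ∀ g : ℂ → ℂ, Admissible k q g (ball 0 R) →
      (∀ z ∈ ball 0 R, ‖g z‖ = 1 → ‖deriv g z‖ ≤ C) → ‖deriv g 0‖ < 1 + ‖g 0‖ ^ 2 := by
  by_contra! hcon
  choose g hga hgC hg0 using fun n : ℕ => hcon (n + 1) (by positivity)
  have hgrow : ∀ n : ℕ, ∀ z : ℂ, 2 * (‖z‖ + 1) < n → ‖g n z‖ ≤ Real.exp (2 * C * (‖z‖ + 1)) := by
    intro n z hz
    have hn : (0 : ℝ) ≤ n := n.cast_nonneg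
    obtain ⟨z₀, hz₀, hgz₀⟩ : ∃ z₀ ∈ ball (0 : ℂ) 1, ‖g n z₀‖ ≤ 1 := by
      by_contra! h1
      exact absurd (hg0 n) (not_le.2 (norm_deriv_lt_one_add_sq
        ((hga n).1.mono (ball_subset_ball (by linarith))) h1))
    rw [mem_ball_zero_iff] at hz₀
    have hsub : ball z₀ (n : ℝ) ⊆ ball 0 ((n : ℝ) + 1) :=
      ball_subset_ball' (by rw [dist_zero_right]; linarith)
    have hzz : ‖z - z₀‖ ≤ ‖z‖ + 1 := (norm_sub_le _ _).trans (by linarith)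
    refine (norm_le_exp_of_deriv_le_on_level hC ((hga n).1.mono hsub)
      (fun w hw => hgC n w (hsub hw)) hgz₀ (by linarith)).trans (Real.exp_le_exp.2 ?_)
    gcongr
  have hadm : ∀ R : ℝ, ∀ᶠ n in atTop, Admissible k q (g n) (ball 0 R) := by
    intro R
    filter_upwards [tendsto_natCast_atTop_atTop.eventually_ge_atTop R] with n hn
    exact (hga n).mono (ball_subset_ball (by linarith))
  have hbound : ∀ z : ℂ, ∀ r : ℝ, ∀ᶠ n in atTop, ∀ w ∈ ball z r,
      ‖g n w‖ ≤ Real.exp (2 * C * (‖z‖ + r + 1)) := by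
    intro z r
    filter_upwards [tendsto_natCast_atTop_atTop.eventually_gt_atTop (2 * (‖z‖ + r + 1))]
      with n hn w hw
    have hwz : ‖w‖ ≤ ‖z‖ + r := by
      rw [mem_ball, dist_eq_norm] at hw
      linarith [norm_sub_norm_le w z]
    refine (hgrow n w (by linarith)).trans (Real.exp_le_exp.2 ?_)
    gcongr
  obtain ⟨φ, hφ, hconv⟩ := exists_subseq_convergesOn (F := g) isLindelof_univ isPreconnected_univ
    fun x _ => ⟨ball x 1, isOpen_ball, mem_ball_self one_pos, fun φ hφ => by
      obtain ⟨ψ, hψ, G, hG⟩ := exists_subseq_tendsto_of_eventually_bounded (F := fun n => g (φ n))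
        (c := x) one_pos (hφ.tendsto_atTop.eventually <| (hadm (‖x‖ + 2)).mono fun n hn =>
          hn.1.mono (ball_subset_ball' (by rw [dist_zero_right]; linarith)))
        (hφ.tendsto_atTop.eventually (hbound x (2 * 1)))
      exact ⟨ψ, hψ, Or.inl ⟨G, hG⟩⟩⟩
  have hφt := hφ.tendsto_atTop
  have hlim : ∀ z, ∀ᶠ n in atTop, ‖g (φ n) z‖ ≤ Real.exp (2 * C * (‖z‖ + 1)) := by
    intro z
    filter_upwards [hφt.eventually
      (tendsto_natCast_atTop_atTop.eventually_gt_atTop (2 * (‖z‖ + 1)))] with n hn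
    exact hgrow _ z hn
  rcases hconv with ⟨G, hG⟩ | hinf
  · have hadm' : ∀ R : ℝ, ∀ᶠ n in atTop, Admissible k q (g (φ n)) (ball 0 R) := fun R =>
      hφt.eventually (hadm R)
    have hGd : Differentiable ℂ G := fun z => by
      have hz : z ∈ ball (0 : ℂ) (‖z‖ + 1) := by rw [mem_ball_zero_iff]; linarith
      exact ((hG.mono (subset_univ _)).differentiableOn
        ((hadm' (‖z‖ + 1)).mono fun n hn => hn.1) isOpen_ball).differentiableAt
          (isOpen_ball.mem_nhds hz)
    have hGE : ExpType G := by
      refine ⟨hGd, 2 * C, by positivity, fun z => ?_⟩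
      rw [add_comm 1]
      exact le_of_tendsto (hG.tendsto_at (mem_univ z)).norm (hlim z)
    refine not_tendstoLocallyUniformlyOn_of_admissible hq hadm' hGE ⟨0, ?_⟩ hG
    have hd := ((hG.mono (subset_univ (ball 0 1))).deriv
      ((hadm' 1).mono fun n hn => hn.1) isOpen_ball).tendsto_at (mem_ball_self one_pos)
    have : 1 ≤ ‖deriv G 0‖ := ge_of_tendsto hd.norm (Eventually.of_forall fun n =>
      le_trans (by nlinarith [sq_nonneg ‖g (φ n) 0‖]) (hg0 (φ n)))
    exact norm_pos_iff.1 (by linarith)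
  · obtain ⟨n, h1, h2⟩ := ((hlim 0).and
      ((hinf.tendsto_norm (mem_univ 0)).eventually_gt_atTop _)).exists
    exact absurd h1 (not_le.2 h2)

/-! ### Zalcman's rescaling -/

/-- The function `ζ ↦ s ^ (-α) f (z + s ζ)` has spherical derivative at least `1` at `0`. -/
def Steep (α : ℝ) (f : ℂ → ℂ) (z : ℂ) (s : ℝ) : Prop :=
  1 + (s ^ (-α) * ‖f z‖) ^ 2 ≤ s ^ (-α) * s * ‖deriv f z‖

/-- At a zero of order `m ≥ k` the left side vanishes to order `(m - 1) k` and the power of `f` on the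
right only to order `m (k - 1)`. -/
theorem eventually_norm_deriv_pow_le {k : ℕ} (hk : 1 ≤ k) {f : ℂ → ℂ} {z₀ : ℂ}
    (hf : AnalyticAt ℂ f z₀) (h0 : f z₀ = 0 → ∀ j < k, iteratedDeriv j f z₀ = 0) :
    ∃ A : ℝ, 0 ≤ A ∧ ∀ᶠ z in 𝓝 z₀, ‖deriv f z‖ ^ k ≤ A * ‖f z‖ ^ (k - 1) := by
  -- it suffices to bound the quotient by a continuous function
  have key : ∀ u v : ℂ → ℂ, ContinuousAt u z₀ → ContinuousAt v z₀ → v z₀ ≠ 0 →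
      ∃ A : ℝ, 0 ≤ A ∧ ∀ᶠ z in 𝓝 z₀, ‖u z‖ ^ k ≤ A * ‖v z‖ ^ (k - 1) := by
    intro u v hu hv hv0
    have hq : ContinuousAt (fun z => ‖u z‖ ^ k / ‖v z‖ ^ (k - 1)) z₀ :=
      (hu.norm.pow k).div (hv.norm.pow _) (pow_ne_zero _ (norm_ne_zero_iff.2 hv0))
    refine ⟨‖u z₀‖ ^ k / ‖v z₀‖ ^ (k - 1) + 1, by positivity, ?_⟩
    filter_upwards [hq.eventually (gt_mem_nhds (lt_add_one _)), hv.eventually_ne hv0]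
      with z hz hvz
    rw [div_lt_iff₀ (pow_pos (norm_pos_iff.2 hvz) _)] at hz
    exact hz.le
  by_cases hfz : f z₀ = 0
  swap
  · exact key _ _ hf.deriv.continuousAt hf.continuousAt hfz
  have hord := (natCast_le_analyticOrderAt_iff_iteratedDeriv_eq_zero hf).2 (h0 hfz)
  by_cases htop : analyticOrderAt f z₀ = ⊤
  · refine ⟨0, le_rfl, ?_⟩
    filter_upwards [(analyticOrderAt_eq_top.1 htop).eventually_nhds] with z hz
    have : f =ᶠ[𝓝 z] fun _ => 0 := hz
    rw [this.deriv_eq, deriv_const, norm_zero, zero_pow (by omega), zero_mul]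
  obtain ⟨m, hm⟩ := ENat.ne_top_iff_exists.1 htop
  obtain ⟨g, hg, hg0, hfg⟩ := (hf.analyticOrderAt_eq_natCast (n := m)).1 hm.symm
  rw [← hm] at hord
  obtain ⟨l, rfl⟩ := Nat.exists_eq_add_of_le (show k ≤ m by exact_mod_cast hord)
  obtain ⟨k, rfl⟩ : ∃ l, k = l + 1 := ⟨k - 1, by omega⟩
  obtain ⟨A, hA, hAe⟩ := key (fun z => (k + 1 + l : ℕ) * g z + (z - z₀) * deriv g z) g
    ((continuousAt_const.mul hg.continuousAt).add
      ((continuousAt_id.sub continuousAt_const).mul hg.deriv.continuousAt)) hg.continuousAt hg0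
  refine ⟨A, hA, ?_⟩
  filter_upwards [hAe, hfg.eventually_nhds, hg.eventually_analyticAt,
    Metric.ball_mem_nhds z₀ one_pos] with z hz hfz hgz hz1
  have hd : deriv f z = (z - z₀) ^ (k + l) * ((k + 1 + l : ℕ) * g z + (z - z₀) * deriv g z) := by
    have h1 : HasDerivAt (fun z => (z - z₀) ^ (k + 1 + l) * g z) _ z :=
      (((hasDerivAt_id z).sub_const z₀).fun_pow (k + 1 + l)).fun_mul
        hgz.differentiableAt.hasDerivAt
    have h2 : f =ᶠ[𝓝 z] fun z => (z - z₀) ^ (k + 1 + l) * g z := hfz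
    rw [h2.deriv_eq, h1.deriv, show k + 1 + l - 1 = k + l by omega, show k + 1 + l = k + l + 1 by
      omega, pow_succ]
    simp only [id]
    ring
  have hle : ‖z - z₀‖ ≤ 1 := by
    rw [← dist_eq_norm]
    exact (mem_ball.1 hz1).le
  rw [hd, hfz.self_of_nhds, smul_eq_mul, norm_mul, norm_mul, mul_pow, mul_pow, norm_pow, norm_pow,
    ← pow_mul, ← pow_mul, Nat.add_sub_cancel]
  have h3 : ‖z - z₀‖ ^ ((k + l) * (k + 1)) ≤ ‖z - z₀‖ ^ ((k + 1 + l) * k) :=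
    pow_le_pow_of_le_one (norm_nonneg _) hle (by nlinarith)
  calc _ ≤ ‖z - z₀‖ ^ ((k + 1 + l) * k) * (A * ‖g z‖ ^ k) :=
        mul_le_mul h3 hz (by positivity) (by positivity)
    _ = _ := by ring

/-- In terms of `x = s ^ (-α) ‖f z‖` steepness reads `(1 + x ^ 2) ^ k ≤ A s ^ (k - α) x ^ (k - 1)`. -/
theorem Steep.one_le {k : ℕ} (hk : 1 ≤ k) {α : ℝ} {f : ℂ → ℂ} {z : ℂ} {s A : ℝ} (hs : 0 < s)
    (hA : 0 ≤ A) (hf : ‖deriv f z‖ ^ k ≤ A * ‖f z‖ ^ (k - 1)) (h : Steep α f z s) :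
    1 ≤ A * s ^ ((k : ℝ) - α) := by
  set x := s ^ (-α) * ‖f z‖ with hx
  have hx0 : 0 ≤ x := by positivity
  have hsα : s ^ α * s ^ (-α) = 1 := by
    rw [← Real.rpow_add hs, add_neg_cancel, Real.rpow_zero]
  have hfx : ‖f z‖ = s ^ α * x := by rw [hx, ← mul_assoc, hsα, one_mul]
  have h1 : (1 + x ^ 2) ^ k ≤ (s ^ (-α) * s * ‖deriv f z‖) ^ k :=
    pow_le_pow_left₀ (by positivity) h k
  have h2 : (s ^ (-α) * s * ‖deriv f z‖) ^ k ≤ A * s ^ ((k : ℝ) - α) * x ^ (k - 1) := by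
    obtain ⟨k, rfl⟩ : ∃ l, k = l + 1 := ⟨k - 1, by omega⟩
    rw [Nat.add_sub_cancel, hfx] at hf
    rw [Nat.add_sub_cancel]
    calc _ = s ^ (-α * (k + 1 : ℕ)) * s ^ ((k + 1 : ℕ) : ℝ) * ‖deriv f z‖ ^ (k + 1) := by
          rw [mul_pow, mul_pow, Real.rpow_mul hs.le, Real.rpow_natCast, Real.rpow_natCast]
      _ ≤ s ^ (-α * (k + 1 : ℕ)) * s ^ ((k + 1 : ℕ) : ℝ) * (A * (s ^ α * x) ^ k) := by gcongr
      _ = A * (s ^ (-α * (k + 1 : ℕ)) * s ^ ((k + 1 : ℕ) : ℝ) * s ^ (α * (k : ℕ))) * x ^ k := by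
          rw [mul_pow, Real.rpow_mul hs.le α, Real.rpow_natCast (s ^ α) k]; ring
      _ = _ := by
          rw [← Real.rpow_add hs, ← Real.rpow_add hs]
          congr 3
          push_cast
          ring
  have hx1 : x ^ (k - 1) ≤ (1 + x ^ 2) ^ k := calc
    x ^ (k - 1) ≤ (1 + x ^ 2) ^ (k - 1) := pow_le_pow_left₀ hx0 (by nlinarith [sq_nonneg (x - 1)]) _
    _ ≤ (1 + x ^ 2) ^ k := pow_le_pow_right₀ (by nlinarith [sq_nonneg x]) (by omega)
  by_contra! hcon
  have hpos : 0 < (1 + x ^ 2) ^ k := by positivity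
  have h3 : A * s ^ ((k : ℝ) - α) * x ^ (k - 1) ≤ A * s ^ ((k : ℝ) - α) * (1 + x ^ 2) ^ k := by
    gcongr
  nlinarith

/-- If all zeros have multiplicity at least `k > α`, steepness is impossible at small scales. -/
theorem exists_le_of_steep {k : ℕ} (hk : 1 ≤ k) {α : ℝ} (hα : α < k) {f : ℂ → ℂ} {K U : Set ℂ}
    (hU : IsOpen U) (hf : DifferentiableOn ℂ f U)
    (h0 : ∀ z ∈ U, f z = 0 → ∀ j < k, iteratedDeriv j f z = 0) (hK : IsCompact K) (hKU : K ⊆ U) :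
    ∃ δ : ℝ, 0 < δ ∧ ∀ z ∈ K, ∀ s : ℝ, 0 < s → Steep α f z s → δ ≤ s := by
  refine hK.induction_on (p := fun K => ∃ δ : ℝ, 0 < δ ∧ ∀ z ∈ K, ∀ s : ℝ, 0 < s →
    Steep α f z s → δ ≤ s) ⟨1, one_pos, by simp⟩ ?_ ?_ ?_
  · rintro s t hst ⟨δ, hδ, h⟩
    exact ⟨δ, hδ, fun z hz => h z (hst hz)⟩
  · rintro s t ⟨δ₁, hδ₁, h₁⟩ ⟨δ₂, hδ₂, h₂⟩
    refine ⟨min δ₁ δ₂, lt_min hδ₁ hδ₂, fun z hz s hs hst => ?_⟩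
    rcases hz with hz | hz
    · exact (min_le_left _ _).trans (h₁ z hz s hs hst)
    · exact (min_le_right _ _).trans (h₂ z hz s hs hst)
  intro z₀ hz₀
  have hzU := hKU hz₀
  obtain ⟨A, hA, hAe⟩ := eventually_norm_deriv_pow_le hk (hf.analyticAt (hU.mem_nhds hzU))
    (h0 z₀ hzU)
  have hpos : 0 < (k : ℝ) - α := sub_pos.2 hα
  refine ⟨_, mem_nhdsWithin_of_mem_nhds hAe, ((A + 1)⁻¹) ^ ((k : ℝ) - α)⁻¹, by positivity,
    fun z hz s hs hst => ?_⟩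
  have h1 := hst.one_le hk hs hA hz
  rw [Real.rpow_inv_le_iff_of_pos (by positivity) hs.le hpos]
  rw [inv_le_iff_one_le_mul₀ (by positivity)]
  nlinarith [Real.rpow_nonneg hs.le ((k : ℝ) - α)]

theorem steep_comp_affine {α : ℝ} {f : ℂ → ℂ} {z ζ : ℂ} {s t : ℝ} (hs : 0 < s) (ht : 0 < t) :
    Steep α (fun ζ => (s ^ (-α) : ℝ) * f (z + s * ζ)) ζ t ↔ Steep α f (z + s * ζ) (s * t) := by
  have hsα : 0 < s ^ (-α) := Real.rpow_pos_of_pos hs _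
  rw [Steep, Steep, deriv_mul_comp_affine, norm_mul, norm_mul, norm_mul, Complex.norm_real,
    Complex.norm_real, Real.norm_of_nonneg hs.le, Real.norm_of_nonneg hsα.le,
    Real.mul_rpow hs.le ht.le]
  ring_nf

/-- **Zalcman's lemma**, with Pang's exponent `α`. The point `z₁` and the scale `s₁` nearly minimise
`s / (R - ‖z - x‖)` among all `(z, s)` where `f` is steep. -/
theorem exists_rescaling {k : ℕ} (hk : 1 ≤ k) {q : ℕ → ℕ} (hq : 1 ≤ q 0) {f : ℂ → ℂ} {x z₀ : ℂ}
    {R ε s₀ : ℝ} (hf : Admissible k q f (ball x R)) (hs₀ : 0 < s₀)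
    (hst : Steep (scalingExponent k q) f z₀ s₀) (hε : 0 < ε) (hz₀ : s₀ < ε * (R - ‖z₀ - x‖)) :
    ∃ g : ℂ → ℂ, Admissible k q g (ball 0 (1 / (2 * ε))) ∧
      Steep (scalingExponent k q) g 0 1 ∧
      ∀ ζ ∈ ball 0 (1 / (2 * ε)), ¬ Steep (scalingExponent k q) g ζ (1 / 4) := by
  set α := scalingExponent k q
  obtain ⟨R', hR', hR'R⟩ : ∃ R', s₀ / ε + ‖z₀ - x‖ < R' ∧ R' < R := by
    refine exists_between ?_
    have : s₀ / ε < R - ‖z₀ - x‖ := by rwa [div_lt_iff₀' hε]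
    linarith
  have hsε : 0 < s₀ / ε := by positivity
  have hz₀R' : ‖z₀ - x‖ < R' := by linarith
  have hR'0 : 0 < R' := (norm_nonneg _).trans_lt hz₀R'
  obtain ⟨δ, hδ, hδs⟩ := exists_le_of_steep hk (scalingExponent_lt hk hq) isOpen_ball hf.1 hf.2
    (isCompact_closedBall x R') (closedBall_subset_ball hR'R)
  set S : Set ℝ := {r | ∃ z s, ‖z - x‖ < R' ∧ 0 < s ∧ Steep α f z s ∧ r = s / (R' - ‖z - x‖)}
  have hS₀ : s₀ / (R' - ‖z₀ - x‖) ∈ S := ⟨z₀, s₀, hz₀R', hs₀, hst, rfl⟩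
  have hSlow : ∀ r ∈ S, δ / R' ≤ r := by
    rintro _ ⟨z, s, hz, hs, hzs, rfl⟩
    have h1 := hδs z (by rw [mem_closedBall, dist_eq_norm]; exact hz.le) s hs hzs
    have h2 := norm_nonneg (z - x)
    rw [div_le_div_iff₀ hR'0 (by linarith)]
    nlinarith
  have hbdd : BddBelow S := ⟨_, hSlow⟩
  have hinf : 0 < sInf S := (div_pos hδ hR'0).trans_le (le_csInf ⟨_, hS₀⟩ hSlow)
  have hinfε : sInf S < ε := by
    refine (csInf_le hbdd hS₀).trans_lt ?_
    rw [div_lt_iff₀ (by linarith), ← div_lt_iff₀' hε]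
    linarith
  obtain ⟨_, ⟨z₁, s₁, hz₁, hs₁, hst₁, rfl⟩, hr⟩ := exists_lt_of_csInf_lt ⟨_, hS₀⟩
    (lt_min (by linarith : sInf S < 2 * sInf S) hinfε)
  obtain ⟨hr2, hrε⟩ := lt_min_iff.1 hr
  have hd1 : 0 < R' - ‖z₁ - x‖ := sub_pos.2 hz₁
  rw [div_lt_iff₀ hd1] at hr2 hrε
  have hnear : ∀ ζ ∈ ball (0 : ℂ) (1 / (2 * ε)),
      (R' - ‖z₁ - x‖) / 2 < R' - ‖z₁ + s₁ * ζ - x‖ := by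
    intro ζ hζ
    rw [mem_ball_zero_iff, lt_div_iff₀ (by positivity)] at hζ
    have h1 : ‖z₁ + s₁ * ζ - x‖ ≤ ‖z₁ - x‖ + s₁ * ‖ζ‖ := by
      rw [show z₁ + s₁ * ζ - x = (z₁ - x) + s₁ * ζ by ring]
      refine (norm_add_le _ _).trans_eq ?_
      rw [norm_mul, Complex.norm_real, Real.norm_of_nonneg hs₁.le]
    have h2 : s₁ * ‖ζ‖ < (R' - ‖z₁ - x‖) / 2 := by
      have h3 : s₁ * ‖ζ‖ ≤ ε * (R' - ‖z₁ - x‖) * ‖ζ‖ := by gcongr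
      nlinarith
    linarith
  refine ⟨fun ζ => (s₁ ^ (-α) : ℝ) * f (z₁ + s₁ * ζ), hf.comp_affine hq hs₁ fun ζ hζ => ?_, ?_,
    fun ζ hζ hcon => ?_⟩
  · rw [mem_ball, dist_eq_norm]
    linarith [hnear ζ hζ]
  · rw [steep_comp_affine hs₁ one_pos]
    simpa using hst₁
  -- the scale `1 / 4` makes up for two factors `2`: the quotient at `(z₁, s₁)` is less than twice the
  -- infimum, and the distance to the boundary is at least half as large as at `z₁`
  · rw [steep_comp_affine hs₁ (by norm_num)] at hcon
    have h1 := hnear ζ hζ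
    have h2 := csInf_le hbdd ⟨_, _, by linarith, by positivity, hcon, rfl⟩
    rw [le_div_iff₀ (by linarith)] at h2
    nlinarith

/-- The uniform bound which replaces Marty's criterion: admissible functions on `ball x R` are not
steep at scales that are small compared with the distance to the boundary. -/
theorem exists_le_scale_of_steep {k : ℕ} (hk : 1 ≤ k) {q : ℕ → ℕ} (hq : 2 ≤ q 0) :
    ∃ ε : ℝ, 0 < ε ∧ ∀ (f : ℂ → ℂ) (x : ℂ) (R : ℝ), Admissible k q f (ball x R) → ∀ (z : ℂ) (s : ℝ),
      0 < s → Steep (scalingExponent k q) f z s → ε * (R - ‖z - x‖) ≤ s := by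
  set α := scalingExponent k q
  set c : ℝ := (1 / 4 : ℝ) ^ (-α)
  have hc : 0 < c := Real.rpow_pos_of_pos (by norm_num) _
  obtain ⟨R, hR, hRg⟩ := exists_radius_norm_deriv_lt (k := k) hq
    (C := (1 + c ^ 2) / (c * (1 / 4))) (by positivity)
  refine ⟨1 / (2 * R), by positivity, fun f x R' hf z s hs hst => ?_⟩
  by_contra! hcon
  obtain ⟨g, hg, hg0, hgs⟩ := exists_rescaling hk (by omega) hf hs hst (by positivity) hcon
  have hRe : 1 / (2 * (1 / (2 * R))) = R := by field_simp
  rw [hRe] at hg hgs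
  have h1 := hRg g hg fun ζ hζ h1 => by
    have := hgs ζ hζ
    rw [Steep, not_le, h1, mul_one] at this
    rw [le_div_iff₀ (by positivity), mul_comm]
    exact this.le
  rw [Steep, Real.one_rpow, one_mul, one_mul, one_mul] at hg0
  linarith

/-! ### Normality in the plane -/

/-- Admissible functions satisfy the hypothesis of `norm_le_exp_of_deriv_le_on_level` with a uniform
constant. -/
theorem exists_norm_deriv_le_on_level {k : ℕ} (hk : 1 ≤ k) {q : ℕ → ℕ} (hq : 2 ≤ q 0) {R : ℝ}
    (hR : 0 < R) : ∃ C : ℝ, 0 ≤ C ∧ ∀ (f : ℂ → ℂ) (x : ℂ), Admissible k q f (ball x R) →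
      ∀ z ∈ ball x (R / 2), ‖f z‖ = 1 → ‖deriv f z‖ ≤ C := by
  obtain ⟨ε, hε, hεs⟩ := exists_le_scale_of_steep hk hq
  set s := ε * R / 4
  have hs : 0 < s := by positivity
  have hc : 0 < s ^ (-scalingExponent k q) := Real.rpow_pos_of_pos hs _
  refine ⟨(1 + (s ^ (-scalingExponent k q)) ^ 2) / (s ^ (-scalingExponent k q) * s),
    by positivity, fun f x hf z hz h1 => ?_⟩
  rw [mem_ball, dist_eq_norm] at hz
  have hns : ¬ Steep (scalingExponent k q) f z s := fun hst => by
    have := hεs f x R hf z s hs hst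
    have h2 : s = ε * (R / 4) := by ring
    rw [h2] at this
    linarith [le_of_mul_le_mul_left this hε]
  rw [Steep, not_le, h1, mul_one] at hns
  rw [le_div_iff₀ (by positivity), mul_comm]
  exact hns.le

theorem tendstoInftyOn_of_inv {X : Type*} [TopologicalSpace X] {F : ℕ → X → ℂ} {L : Filter ℕ}
    {U : Set X} (h : TendstoLocallyUniformlyOn (fun n x => (F n x)⁻¹) (fun _ => 0) L U)
    (h0 : ∀ᶠ n in L, ∀ x ∈ U, F n x ≠ 0) : TendstoInftyOn F L U := by
  intro C x hx
  obtain ⟨t, ht, H⟩ := Metric.tendstoLocallyUniformlyOn_iff.1 h (|C| + 1)⁻¹ (by positivity) x hx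
  refine ⟨t ∩ U, inter_mem ht self_mem_nhdsWithin, ?_⟩
  filter_upwards [H, h0] with n hn hn0 y hy
  have h1 := hn y hy.1
  rw [dist_zero_left, norm_inv, inv_lt_inv₀ (norm_pos_iff.2 (hn0 y hy.2)) (by positivity)] at h1
  linarith [le_abs_self C]

/-- A sequence of functions with `‖F n‖ > 1` on a disc has a subsequence converging to a finite
function or to `∞`. -/
theorem exists_subseq_convergesOn_of_one_lt_norm {F : ℕ → ℂ → ℂ} {c : ℂ} {r : ℝ} (hr : 0 < r)
    (hF : ∀ᶠ n in atTop, DifferentiableOn ℂ (F n) (ball c (2 * r)))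
    (h1 : ∀ᶠ n in atTop, ∀ z ∈ ball c (2 * r), 1 < ‖F n z‖) :
    ∃ φ : ℕ → ℕ, StrictMono φ ∧ ConvergesOn (fun n => F (φ n)) atTop (ball c r) := by
  have hne : ∀ᶠ n in atTop, ∀ z ∈ ball c (2 * r), F n z ≠ 0 := h1.mono fun n hn z hz h0 => by
    have := hn z hz
    rw [h0, norm_zero] at this
    linarith
  have hFinv : ∀ᶠ n in atTop, DifferentiableOn ℂ (fun z => (F n z)⁻¹) (ball c (2 * r)) :=
    (hF.and hne).mono fun n hn => hn.1.fun_inv hn.2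
  obtain ⟨φ, hφ, h, hh⟩ := exists_subseq_tendsto_of_eventually_bounded
    (F := fun n z => (F n z)⁻¹) (B := 1) hr hFinv (h1.mono fun n hn z hz => by
        rw [norm_inv]
        exact inv_le_one_of_one_le₀ (hn z hz).le)
  refine ⟨φ, hφ, ?_⟩
  have hsub : ball c r ⊆ ball c (2 * r) := ball_subset_ball (by linarith)
  have hne' : ∀ᶠ n in atTop, ∀ z ∈ ball c r, F (φ n) z ≠ 0 :=
    hφ.tendsto_atTop.eventually (hne.mono fun n hn z hz => hn z (hsub hz))
  have hd : ∀ᶠ n in atTop, DifferentiableOn ℂ (fun z => (F (φ n) z)⁻¹) (ball c r) :=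
    hφ.tendsto_atTop.eventually (hFinv.mono fun n hn => hn.mono hsub)
  have hhd := hh.differentiableOn hd isOpen_ball
  by_cases h0 : ∀ z ∈ ball c r, h z ≠ 0
  · left
    refine ⟨fun z => (h z)⁻¹, ?_⟩
    have := hh.fun_inv₀ hhd.continuousOn h0
    simpa only [inv_inv] using this
  · right
    push Not at h0
    obtain ⟨z₀, hz₀, hhz⟩ := h0
    have hev : ∀ᶠ z in 𝓝 z₀, h z = 0 := by
      by_contra hev
      obtain ⟨ρ, hρ, hρs⟩ := Metric.isOpen_iff.1 isOpen_ball z₀ hz₀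
      obtain ⟨n, ⟨z, hz, hz0⟩, hn⟩ :=
        ((eventually_exists_zero isOpen_ball hd hh hz₀ hhz hev hρ).and hne').exists
      exact hn z (hρs hz) (inv_eq_zero.1 hz0)
    have heq := (hhd.analyticOnNhd isOpen_ball).eqOn_zero_of_preconnected_of_eventuallyEq_zero
      (convex_ball c r).isPreconnected hz₀ hev
    exact tendstoInftyOn_of_inv (hh.congr_right heq) hne'

/-- The theorem near a point of the plane. -/
theorem exists_subseq_convergesOn_ball {k : ℕ} (hk : 1 ≤ k) {q : ℕ → ℕ} (hq : 2 ≤ q 0)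
    {F : ℕ → ℂ → ℂ} {x : ℂ} {R : ℝ} (hR : 0 < R)
    (hF : ∀ᶠ n in atTop, Admissible k q (F n) (ball x R)) :
    ∃ φ : ℕ → ℕ, StrictMono φ ∧ ConvergesOn (fun n => F (φ n)) atTop (ball x (R / 64)) := by
  obtain ⟨C, hC, hCf⟩ := exists_norm_deriv_le_on_level hk hq hR
  -- either `‖F n‖ ≤ 1` somewhere near `x` for infinitely many `n`, and these `F n` are bounded near
  -- `x` by the growth estimate, or `‖F n‖ > 1` near `x` from some index on
  by_cases hfreq : ∃ᶠ n in atTop, ∃ z₀ ∈ ball x (R / 32), ‖F n z₀‖ ≤ 1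
  · obtain ⟨φ, hφ, hφf⟩ := extraction_of_frequently_atTop (hfreq.and_eventually hF)
    obtain ⟨ψ, hψ, g, hg⟩ := exists_subseq_tendsto_of_eventually_bounded (F := fun n => F (φ n))
      (c := x) (r := R / 64) (B := Real.exp (2 * C * R)) (by positivity)
      (Eventually.of_forall fun n => (hφf n).2.1.mono (ball_subset_ball (by linarith)))
      (Eventually.of_forall fun n z hz => by
        obtain ⟨⟨z₀, hz₀, h1⟩, hadm⟩ := hφf n
        have hsub : ball z₀ (R / 4) ⊆ ball x (R / 2) :=
          ball_subset_ball' (by linarith [mem_ball.1 hz₀])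
        have hzz : ‖z - z₀‖ < R / 16 := by
          rw [← dist_eq_norm]
          linarith [dist_triangle_right z z₀ x, mem_ball.1 hz₀, mem_ball.1 hz]
        refine (norm_le_exp_of_deriv_le_on_level hC
          (hadm.1.mono (hsub.trans (ball_subset_ball (by linarith))))
          (fun w hw => hCf _ x hadm w (hsub hw)) h1 (by linarith)).trans (Real.exp_le_exp.2 ?_)
        gcongr
        linarith)
    exact ⟨φ ∘ ψ, hφ.comp hψ, Or.inl ⟨g, hg⟩⟩
  · rw [not_frequently] at hfreq
    refine exists_subseq_convergesOn_of_one_lt_norm (by positivity)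
      (hF.mono fun n hn => hn.1.mono (ball_subset_ball (by linarith)))
      (hfreq.mono fun n hn z hz => ?_)
    by_contra! hcon
    exact hn ⟨z, by convert hz using 2; ring, hcon⟩

/-- A sequence that is locally, from some index on, admissible on a domain of the plane is normal
there. -/
theorem exists_subseq_convergesOn_of_admissible {k : ℕ} (hk : 1 ≤ k) {q : ℕ → ℕ} (hq : 2 ≤ q 0)
    {F : ℕ → ℂ → ℂ} {D : Set ℂ} (hD : IsPreconnected D)
    (hF : ∀ x ∈ D, ∃ R > 0, ∀ᶠ n in atTop, Admissible k q (F n) (ball x R)) :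
    ∃ φ : ℕ → ℕ, StrictMono φ ∧ ConvergesOn (fun n => F (φ n)) atTop D := by
  refine exists_subseq_convergesOn (HereditarilyLindelofSpace.isLindelof D) hD fun x hx => ?_
  obtain ⟨R, hR, hadm⟩ := hF x hx
  exact ⟨ball x (R / 64), isOpen_ball, mem_ball_self (by positivity), fun φ hφ =>
    exists_subseq_convergesOn_ball hk hq hR (hφ.tendsto_atTop.eventually hadm)⟩

/-! ### The coordinate at infinity -/

theorem isPreconnected_lt_norm (r : ℝ) (hr : 0 < r) : IsPreconnected {z : ℂ | r < ‖z‖} := by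
  have : {z : ℂ | r < ‖z‖} = Complex.exp '' {z : ℂ | Real.log r < z.re} := by
    ext z
    constructor
    · intro hz
      have hz' : r < ‖z‖ := hz
      have h0 : 0 < ‖z‖ := hr.trans hz'
      exact ⟨Complex.log z, by
        change Real.log r < (Complex.log z).re
        rw [Complex.log_re]
        exact Real.log_lt_log hr hz', Complex.exp_log (norm_pos_iff.1 h0)⟩
    · rintro ⟨w, hw, rfl⟩
      have hw' : Real.log r < w.re := hw
      change r < ‖Complex.exp w‖
      rwa [Complex.norm_exp, ← Real.log_lt_iff_lt_exp hr]
  rw [this]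
  exact (convex_halfSpace_re_gt _).isPreconnected.image _ Complex.continuous_exp.continuousOn

/-- Uniform convergence of holomorphic functions on a circle extends to the disc. -/
theorem exists_tendstoUniformlyOn_closedBall {F : ℕ → ℂ → ℂ} {g : ℂ → ℂ} {c : ℂ} {r : ℝ}
    (hr : 0 < r) (hF : ∀ᶠ n in atTop, DifferentiableOn ℂ (F n) (closedBall c r))
    (h : TendstoUniformlyOn F g atTop (sphere c r)) :
    ∃ g' : ℂ → ℂ, TendstoUniformlyOn F g' atTop (closedBall c r) := by
  have hC : UniformCauchySeqOn F atTop (closedBall c r) := by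
    rw [Metric.uniformCauchySeqOn_iff]
    intro ε hε
    obtain ⟨N, hN⟩ := Metric.uniformCauchySeqOn_iff.1 h.uniformCauchySeqOn (ε / 2) (half_pos hε)
    obtain ⟨N', hN'⟩ := eventually_atTop.1 hF
    refine ⟨max N N', fun m hm n hn x hx => ?_⟩
    have hm' := max_le_iff.1 hm
    have hn' := max_le_iff.1 hn
    have hd : DiffContOnCl ℂ (fun z => F m z - F n z) (ball c r) :=
      ((hN' m hm'.2).sub (hN' n hn'.2)).diffContOnCl_ball subset_rfl
    have := Complex.norm_le_of_forall_mem_frontier_norm_le (C := ε / 2) isBounded_ball hd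
      (fun w hw => by
        rw [frontier_ball c hr.ne'] at hw
        rw [← dist_eq_norm]
        exact (hN m hm'.1 n hn'.1 w hw).le) (by rwa [closure_ball c hr.ne'])
    rw [dist_eq_norm]
    linarith
  choose! g' hg' using fun x (hx : x ∈ closedBall c r) =>
    cauchySeq_tendsto_of_complete (hC.cauchySeq hx)
  exact ⟨g', hC.tendstoUniformlyOn_of_tendsto hg'⟩

/-- In the coordinate `w = 1 / z`, the derivative `d/dz` is `- w ^ 2 d/dw`. -/
theorem derivation_iterate_inv {G : ℂ → ℂ} {U : Set ℂ} (hU : IsOpen U)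
    (hG : DifferentiableOn ℂ G U) (i : ℕ) {w : ℂ} (hw : w ∈ U) (hw0 : w ≠ 0) :
    (derivation fun w => -w ^ 2)^[i] G w = iteratedDeriv i (fun z => G z⁻¹) w⁻¹ := by
  induction i generalizing w with
  | zero => simp
  | succ i ih =>
    rw [Function.iterate_succ_apply', iteratedDeriv_succ, derivation]
    have hw' : w⁻¹ ≠ 0 := inv_ne_zero hw0
    have hUn : ∀ᶠ z in 𝓝 w⁻¹, z⁻¹ ∈ U := by
      have : ContinuousAt (fun z : ℂ => z⁻¹) w⁻¹ := continuousAt_inv₀ hw'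
      exact this (by simpa using hU.mem_nhds hw)
    have hev : iteratedDeriv i (fun z => G z⁻¹) =ᶠ[𝓝 w⁻¹]
        fun z => (derivation fun w => -w ^ 2)^[i] G z⁻¹ := by
      filter_upwards [hUn, isOpen_ne.mem_nhds hw'] with z hz hz0
      rw [ih hz (inv_ne_zero hz0), inv_inv]
    have hd : HasDerivAt ((derivation fun w => -w ^ 2)^[i] G)
        (deriv ((derivation fun w => -w ^ 2)^[i] G) w) (w⁻¹)⁻¹ := by
      rw [inv_inv]
      exact ((differentiableOn_derivation_iterate (by fun_prop) hU hG i).differentiableAt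
        (hU.mem_nhds hw)).hasDerivAt
    have h2 : HasDerivAt (fun z => (derivation fun w => -w ^ 2)^[i] G z⁻¹) _ w⁻¹ :=
      hd.comp w⁻¹ (hasDerivAt_inv hw')
    rw [hev.deriv_eq, h2.deriv]
    field_simp

theorem diffMonomial_inv {G : ℂ → ℂ} {U : Set ℂ} (hU : IsOpen U) (hG : DifferentiableOn ℂ G U)
    {k : ℕ} {q : ℕ → ℕ} {w : ℂ} (hw : w ∈ U) (hw0 : w ≠ 0) :
    diffMonomial (fun w => -w ^ 2) k q G w =
      diffMonomial (fun _ => 1) k q (fun z => G z⁻¹) w⁻¹ :=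
  Finset.prod_congr rfl fun i _ => by
    rw [derivation_iterate_inv hU hG i hw hw0, derivation_one_iterate]

theorem derivation_iterate_zero {k : ℕ} (hk : 1 ≤ k) (G : ℂ → ℂ) :
    (derivation fun w => -w ^ 2)^[k] G 0 = 0 := by
  obtain ⟨k, rfl⟩ : ∃ l, k = l + 1 := ⟨k - 1, by omega⟩
  rw [Function.iterate_succ_apply', derivation]
  simp

theorem deriv_eq_zero_of_derivation_iterate_eq_zero (i : ℕ) {G : ℂ → ℂ} (hG : Differentiable ℂ G)
    (h : ∀ w, (derivation fun w => -w ^ 2)^[i] G w = 0) (w : ℂ) : deriv G w = 0 := by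
  induction i generalizing G w with
  | zero =>
    have : G = fun _ => 0 := funext h
    rw [this, deriv_const]
  | succ i ih =>
    have hd : Differentiable ℂ (derivation (fun w => -w ^ 2) G) := by
      have := differentiableOn_derivation_iterate (m := fun w => -w ^ 2) (by fun_prop) isOpen_univ
        hG.differentiableOn 1
      exact differentiableOn_univ.1 this
    have hconst := is_const_of_deriv_eq_zero hd (ih hd fun w => h w)
    have hne : ∀ w ∈ ({0}ᶜ : Set ℂ), deriv G w = 0 := by
      intro w hw
      have h1 := hconst w 0
      simp only [derivation] at h1
      simpa [show w ≠ 0 from hw] using h1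
    have hcl : closure ({0}ᶜ : Set ℂ) ⊆ {w | deriv G w = 0} :=
      closure_minimal hne (isClosed_eq hG.deriv.continuous continuous_const)
    rw [closure_compl_singleton] at hcl
    exact hcl (mem_univ w)

/-- If `1 / G` has at most polynomial growth outside a disc, then `1 / G` has no essential
singularity at `∞`, and neither has `G`; in particular `G` is of exponential type. -/
theorem expType_of_one_le_norm_mul {G : ℂ → ℂ} (hG : Differentiable ℂ G) (N : ℕ)
    (h : ∀ w, 1 < ‖w‖ → 1 ≤ ‖G w‖ * ‖w‖ ^ N) : ExpType G := by
  set v : ℂ → ℂ := fun u => (G u⁻¹)⁻¹ * u ^ N with hv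
  have hinv : ∀ u ∈ ball (0 : ℂ) 1 \ {0}, 1 < ‖u⁻¹‖ := by
    rintro u ⟨hu, hu0⟩
    rw [norm_inv]
    exact (one_lt_inv₀ (norm_pos_iff.2 hu0)).2 (mem_ball_zero_iff.1 hu)
  have hGne : ∀ u ∈ ball (0 : ℂ) 1 \ {0}, G u⁻¹ ≠ 0 := by
    intro u hu h0
    have := h _ (hinv u hu)
    rw [h0, norm_zero, zero_mul] at this
    linarith
  have hvd : DifferentiableOn ℂ v (ball 0 1 \ {0}) := by
    intro u hu
    have hu0 : u ≠ 0 := hu.2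
    exact (((hG.differentiableAt.comp u (differentiableAt_inv hu0)).fun_inv (hGne u hu)).fun_mul
      (differentiableAt_id.pow N)).differentiableWithinAt
  have hvb : ∀ u ∈ ball (0 : ℂ) 1 \ {0}, ‖v u‖ ≤ 1 := by
    intro u hu
    have h1 := h _ (hinv u hu)
    have hu0 : 0 < ‖u‖ := norm_pos_iff.2 hu.2
    rw [norm_inv, inv_pow, ← div_eq_mul_inv, one_le_div (pow_pos hu0 N)] at h1
    rw [hv]
    simp only [norm_mul, norm_inv, norm_pow]
    rw [← div_eq_inv_mul]
    exact div_le_one_of_le₀ h1 (norm_nonneg _)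
  set V := Function.update v 0 ((𝓝[≠] (0 : ℂ)).limUnder v)
  have hV : DifferentiableOn ℂ V (ball 0 1) :=
    Complex.differentiableOn_update_limUnder_of_bddAbove (ball_mem_nhds 0 one_pos) hvd
      ⟨1, by rintro _ ⟨u, hu, rfl⟩; exact hvb u hu⟩
  have hVv : ∀ u ∈ ball (0 : ℂ) 1 \ {0}, V u = v u := fun u hu =>
    Function.update_of_ne hu.2 _ _
  have hVne : ¬ ∀ᶠ u in 𝓝 (0 : ℂ), V u = 0 := by
    intro hev
    have h1 : ∀ᶠ u in 𝓝[≠] (0 : ℂ), V u = 0 := hev.filter_mono nhdsWithin_le_nhds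
    have h2 : ∀ᶠ u in 𝓝[≠] (0 : ℂ), u ∈ ball (0 : ℂ) 1 :=
      mem_nhdsWithin_of_mem_nhds (ball_mem_nhds (0 : ℂ) one_pos)
    have h3 : ∀ᶠ u in 𝓝[≠] (0 : ℂ), u ∈ ({0}ᶜ : Set ℂ) := self_mem_nhdsWithin
    obtain ⟨u, hu0, hu1, hu2⟩ := (h1.and (h2.and h3)).exists
    rw [hVv u ⟨hu1, hu2⟩] at hu0
    exact mul_ne_zero (inv_ne_zero (hGne u ⟨hu1, hu2⟩)) (pow_ne_zero N hu2) hu0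
  obtain ⟨j, e, he, he0, hVe⟩ := (hV.analyticAt
    (ball_mem_nhds 0 one_pos)).exists_eventuallyEq_pow_smul_nonzero_iff.2 hVne
  have hc : 0 < ‖e 0‖ := norm_pos_iff.2 he0
  obtain ⟨δ, hδ, hδs⟩ := Metric.eventually_nhds_iff_ball.1 (hVe.and
    ((he.continuousAt.norm.eventually (lt_mem_nhds (half_lt_self hc))).and
      (isOpen_ball.eventually_mem (mem_ball_self (x := (0 : ℂ)) one_pos))))
  obtain ⟨B, hB⟩ := (isCompact_closedBall (0 : ℂ) δ⁻¹).exists_bound_of_continuousOn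
    hG.continuous.continuousOn
  have hB0 : 0 ≤ B := (norm_nonneg _).trans (hB 0 (mem_closedBall_self (by positivity)))
  have hfar : ∀ w, δ⁻¹ < ‖w‖ → ‖G w‖ ≤ (‖e 0‖ / 2)⁻¹ * ‖w‖ ^ j := by
    intro w hw
    have hw0 : 0 < ‖w‖ := (inv_pos.2 hδ).trans hw
    have hwb : w⁻¹ ∈ ball (0 : ℂ) δ := by
      rw [mem_ball_zero_iff, norm_inv]
      exact inv_lt_of_inv_lt₀ hδ hw
    obtain ⟨h1, h2, h3⟩ := hδs _ hwb
    have hmem : w⁻¹ ∈ ball (0 : ℂ) 1 \ {0} := ⟨h3, inv_ne_zero (norm_pos_iff.1 hw0)⟩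
    have hGw := hGne _ hmem
    rw [inv_inv] at hGw
    rw [hVv _ hmem, hv] at h1
    simp only [inv_inv, sub_zero, smul_eq_mul] at h1
    have h4 := congrArg norm h1
    simp only [norm_mul, norm_inv, norm_pow] at h4
    have hw1 : 1 < ‖w‖ := by simpa using hinv _ hmem
    have h5 : (‖w‖⁻¹) ^ N ≤ 1 := pow_le_one₀ (by positivity) (inv_le_one_of_one_le₀ hw1.le)
    have h6 : (‖w‖⁻¹) ^ j * (‖e 0‖ / 2) ≤ ‖G w‖⁻¹ := by
      calc _ ≤ (‖w‖⁻¹) ^ j * ‖e w⁻¹‖ := by gcongr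
        _ = ‖G w‖⁻¹ * (‖w‖⁻¹) ^ N := h4.symm
        _ ≤ ‖G w‖⁻¹ := mul_le_of_le_one_right (by positivity) h5
    have h7 := inv_anti₀ (by positivity) h6
    rw [inv_inv, mul_inv, inv_pow, inv_inv, mul_comm] at h7
    exact h7
  refine ⟨hG, B + (‖e 0‖ / 2)⁻¹ + j, by positivity, fun w => ?_⟩
  have hwn := norm_nonneg w
  have hexp : ‖w‖ ^ j ≤ Real.exp (j * (1 + ‖w‖)) := by
    rw [Real.exp_nat_mul]
    exact pow_le_pow_left₀ hwn (by linarith [Real.add_one_le_exp (1 + ‖w‖)]) j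
  have hone : 1 ≤ Real.exp (j * (1 + ‖w‖)) := Real.one_le_exp (by positivity)
  have hA : B + (‖e 0‖ / 2)⁻¹ ≤ Real.exp ((B + (‖e 0‖ / 2)⁻¹) * (1 + ‖w‖)) := by
    have h1 := Real.add_one_le_exp ((B + (‖e 0‖ / 2)⁻¹) * (1 + ‖w‖))
    have h2 : 0 ≤ B + (‖e 0‖ / 2)⁻¹ := by positivity
    nlinarith [mul_nonneg h2 hwn]
  rw [add_mul, Real.exp_add]
  have hmain : ‖G w‖ ≤ (B + (‖e 0‖ / 2)⁻¹) * Real.exp (j * (1 + ‖w‖)) := by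
    have hi : 0 ≤ (‖e 0‖ / 2)⁻¹ := by positivity
    rcases le_or_gt ‖w‖ δ⁻¹ with hw | hw
    · have := hB w (by rwa [mem_closedBall_zero_iff])
      nlinarith
    · have := hfar w hw
      nlinarith
  exact hmain.trans (by gcongr)

/-- The only limit functions at `∞` are constants: `M = ∏ (δ^i G) ^ q_i` for `δ = - w ^ 2 d/dw`
vanishes at `0` together with its derivative, so if it omits `1` it is identically zero. -/
theorem deriv_eq_zero_of_diffMonomial_ne_one {G : ℂ → ℂ} (hG : ExpType G) {k : ℕ} (hk : 1 ≤ k)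
    {q : ℕ → ℕ} (hqk : 1 ≤ q k) (h : ∀ w, diffMonomial (fun w => -w ^ 2) k q G w ≠ 1) (w : ℂ) :
    deriv G w = 0 := by
  set M := diffMonomial (fun w => -w ^ 2) k q G with hM
  have hm : ExpType fun w => -w ^ 2 := by
    simpa using (ExpType.const (-1)).mul (ExpType.id.pow 2)
  have hδ0 : (derivation fun w => -w ^ 2)^[k] G 0 = 0 := derivation_iterate_zero hk G
  have hM0 : M 0 = 0 := diffMonomial_eq_zero_of_eq_zero le_rfl hqk hδ0
  have hME : ExpType M := hm.diffMonomial hG k q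
  obtain ⟨a, b, hab⟩ := (hME.add (ExpType.const (-1))).exists_eq_exp_affine fun w hw =>
    h w (by rwa [← sub_eq_add_neg, sub_eq_zero] at hw)
  have hMab : M = fun w => Complex.exp (a * w + b) + 1 := by
    ext w
    rw [← hab w]
    ring
  have hd0 : HasDerivAt M 0 0 := by
    have h1 : HasDerivAt ((derivation fun w => -w ^ 2)^[k] G) 0 0 := by
      obtain ⟨l, rfl⟩ : ∃ l, k = l + 1 := ⟨k - 1, by omega⟩
      rw [Function.iterate_succ_apply']
      have h2 : HasDerivAt (fun w : ℂ => -w ^ 2) 0 0 := by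
        simpa using ((hasDerivAt_id (0 : ℂ)).fun_pow 2).fun_neg
      have h3 := h2.fun_mul ((hm.derivation_iterate hG l).deriv.1 0).hasDerivAt
      refine (h3.congr_deriv ?_ : HasDerivAt (derivation _ _) 0 0)
      simp
    have h4 : DifferentiableAt ℂ (fun w => ∏ i ∈ Finset.range k,
        ((derivation fun w => -w ^ 2)^[i] G w) ^ q i) 0 :=
      (ExpType.prod _ fun i _ => (hm.derivation_iterate hG i).pow _).1 0
    have h5 := h4.hasDerivAt.fun_mul (h1.fun_pow (q k))
    have h6 : M = fun w => (∏ i ∈ Finset.range k, ((derivation fun w => -w ^ 2)^[i] G w) ^ q i) *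
        ((derivation fun w => -w ^ 2)^[k] G w) ^ q k := by
      ext w
      rw [hM, diffMonomial, Finset.prod_range_succ]
    rw [h6]
    refine h5.congr_deriv ?_
    rw [hδ0, zero_pow (by omega)]
    ring
  have hd1 : HasDerivAt M (Complex.exp (a * 0 + b) * (a * 1)) 0 := by
    rw [hMab]
    exact ((((hasDerivAt_id (0 : ℂ)).const_mul a).add_const b).cexp).add_const 1
  have ha : a = 0 := by
    simpa [Complex.exp_ne_zero] using hd1.unique hd0
  have hMz : ∀ w, M w = 0 := by
    intro w
    rw [← hM0, hMab, ha]
    simp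
  obtain ⟨i, -, hi⟩ := exists_derivation_iterate_eq_zero hm.1 hG.1 hMz
  exact deriv_eq_zero_of_derivation_iterate_eq_zero i hG.1 hi w

/-! ### Normality at infinity -/

theorem tendstoUniformlyOn_sphere_zero {G : ℕ → ℂ → ℂ} {g : ℂ → ℂ}
    (h : TendstoLocallyUniformlyOn G g atTop {0}ᶜ) {R : ℝ} (hR : 0 < R) :
    TendstoUniformlyOn G g atTop (sphere 0 R) :=
  (tendstoLocallyUniformlyOn_iff_forall_isCompact isOpen_compl_singleton).1 h _
    (fun z hz => by
      have : z ≠ 0 := ne_of_mem_sphere hz hR.ne'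
      exact this) (isCompact_sphere 0 R)

/-- Locally uniform convergence on the punctured plane extends to the plane. -/
theorem exists_tendstoLocallyUniformlyOn_univ {G : ℕ → ℂ → ℂ} {g : ℂ → ℂ}
    (hG : ∀ R : ℝ, ∀ᶠ n in atTop, DifferentiableOn ℂ (G n) (ball 0 R))
    (h : TendstoLocallyUniformlyOn G g atTop {0}ᶜ) :
    ∃ g' : ℂ → ℂ, TendstoLocallyUniformlyOn G g' atTop univ := by
  have hconv : ConvergesOn G atTop univ := by
    refine ConvergesOn.of_forall_exists_nhds isPreconnected_univ fun x _ => ?_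
    have hR : 0 < ‖x‖ + 1 := by positivity
    obtain ⟨g', hg'⟩ := exists_tendstoUniformlyOn_closedBall hR
      ((hG (‖x‖ + 2)).mono fun n hn => hn.mono (closedBall_subset_ball (by linarith)))
      (tendstoUniformlyOn_sphere_zero h hR)
    refine ⟨ball 0 (‖x‖ + 1), isOpen_ball, by rw [mem_ball_zero_iff]; linarith, Or.inl ⟨g', ?_⟩⟩
    exact hg'.tendstoLocallyUniformlyOn.mono ball_subset_closedBall
  refine hconv.resolve_right fun hinf => ?_
  exact not_tendsto_nhds_of_tendsto_atTop (hinf.tendsto_norm (mem_univ 1)) _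
    (h.tendsto_at (by simp : (1 : ℂ) ∈ ({0}ᶜ : Set ℂ))).norm

/-- Let `H n → ∞` near the puncture, where `H n` is an admissible function in the coordinate
`w = 1 / z`. Let `μ n` be the largest modulus of a point with `‖H n w‖ ≤ ‖w‖ ^ (-α)`; it tends to
`0`. The rescaled functions `w ↦ μ n ^ α * H n (μ n * w)` have a limit, which can only be a nonzero
constant. So `H n` has no zeros in the disc of radius `μ n`, nor, by the choice of `μ n`, outside
that disc. -/
theorem exists_subseq_ne_zero {k : ℕ} (hk : 1 ≤ k) {q : ℕ → ℕ} (hq : 2 ≤ q 0) (hqk : 1 ≤ q k)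
    {H : ℕ → ℂ → ℂ} {r : ℝ} (hr : 0 < r) (hH : ∀ n, DifferentiableOn ℂ (H n) (ball 0 r))
    (hA : ∀ n, Admissible k q (fun z => H n z⁻¹) {z | r⁻¹ < ‖z‖})
    (hinf : TendstoInftyOn H atTop (ball 0 r \ {0})) :
    ∃ φ : ℕ → ℕ, StrictMono φ ∧ ∀ᶠ n in atTop, ∀ w ∈ closedBall (0 : ℂ) (r / 2),
      H (φ n) w ≠ 0 := by
  set α := scalingExponent k q
  have hα : 0 < α := scalingExponent_pos hk (by omega) hqk
  have hαk : α < k := scalingExponent_lt hk (by omega)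
  have hρ : 0 < r / 2 := half_pos hr
  have hρr : closedBall (0 : ℂ) (r / 2) ⊆ ball 0 r := closedBall_subset_ball (half_lt_self hr)
  have hcontn : ∀ n, ContinuousOn (fun w => ‖H n w‖ * ‖w‖ ^ α) (ball 0 r) := fun n =>
    (hH n).continuousOn.norm.mul
      (continuous_norm.continuousOn.rpow_const fun _ _ => Or.inr hα.le)
  have hex : ∀ n, ∃ p : ℂ, 0 < ‖p‖ ∧ ‖p‖ ≤ r / 2 ∧ ‖H n p‖ * ‖p‖ ^ α ≤ 1 ∧
      ∀ w : ℂ, ‖p‖ < ‖w‖ → ‖w‖ ≤ r / 2 → 1 < ‖H n w‖ * ‖w‖ ^ α := by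
    intro n
    have hcomp : IsCompact (closedBall (0 : ℂ) (r / 2) ∩ {w | ‖H n w‖ * ‖w‖ ^ α ≤ 1}) :=
      (isCompact_closedBall 0 (r / 2)).of_isClosed_subset
        (((hcontn n).mono hρr).preimage_isClosed_of_isClosed isClosed_closedBall isClosed_Iic)
        inter_subset_left
    have h0 : (0 : ℂ) ∈ ball (0 : ℂ) r := mem_ball_self hr
    have hev : ∀ᶠ w in 𝓝 (0 : ℂ), ‖H n w‖ * ‖w‖ ^ α < 1 := by
      have h1 : ContinuousAt (fun w => ‖H n w‖ * ‖w‖ ^ α) 0 :=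
        (hcontn n).continuousAt (isOpen_ball.mem_nhds h0)
      refine h1.eventually (gt_mem_nhds ?_)
      simp [Real.zero_rpow hα.ne']
    have h2 : ∀ᶠ w in 𝓝[≠] (0 : ℂ), w ∈ ball (0 : ℂ) (r / 2) :=
      mem_nhdsWithin_of_mem_nhds (ball_mem_nhds 0 hρ)
    have h3 : ∀ᶠ w in 𝓝[≠] (0 : ℂ), w ∈ ({0}ᶜ : Set ℂ) := self_mem_nhdsWithin
    obtain ⟨w₀, hw₀, hw₀r, hw₀0⟩ :=
      ((hev.filter_mono nhdsWithin_le_nhds).and (h2.and h3)).exists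
    have hw₀m : w₀ ∈ closedBall (0 : ℂ) (r / 2) ∩ {w | ‖H n w‖ * ‖w‖ ^ α ≤ 1} :=
      ⟨ball_subset_closedBall hw₀r, hw₀.le⟩
    obtain ⟨p, ⟨hpb, hp1⟩, hmax⟩ := hcomp.exists_isMaxOn ⟨w₀, hw₀m⟩
      continuous_norm.continuousOn
    refine ⟨p, (norm_pos_iff.2 hw₀0).trans_le (isMaxOn_iff.1 hmax w₀ hw₀m),
      mem_closedBall_zero_iff.1 hpb, hp1, fun w hpw hw => ?_⟩
    by_contra! hcon
    exact absurd (isMaxOn_iff.1 hmax w ⟨mem_closedBall_zero_iff.2 hw, hcon⟩) (not_le.2 hpw)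
  choose p hp0 hpr hp1 hpmax using hex
  -- `lam n = 1 / μ n` is the modulus in the coordinate `z`
  set lam : ℕ → ℝ := fun n => ‖p n‖⁻¹ with hlam
  have hlam0 : ∀ n, 0 < lam n := fun n => inv_pos.2 (hp0 n)
  have hptend : Tendsto (fun n => ‖p n‖) atTop (𝓝 0) := by
    refine tendsto_order.2 ⟨fun a ha => Eventually.of_forall fun n => ha.trans (hp0 n),
      fun ε hε => ?_⟩
    have hK : IsCompact (closedBall (0 : ℂ) (r / 2) ∩ {w | ε ≤ ‖w‖}) :=
      (isCompact_closedBall 0 (r / 2)).inter_right (isClosed_le continuous_const continuous_norm)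
    have hεα : 0 < ε ^ α := Real.rpow_pos_of_pos hε α
    filter_upwards [hinf.eventually_forall_le hK (fun w hw => ⟨hρr hw.1, fun h0 => by
      have h1 : ε ≤ ‖w‖ := hw.2
      rw [show w = 0 from h0, norm_zero] at h1
      linarith⟩) (2 * (ε ^ α)⁻¹)] with n hn
    by_contra! hcon
    have h1 := hn (p n) ⟨mem_closedBall_zero_iff.2 (hpr n), hcon⟩
    have h2 : ε ^ α ≤ ‖p n‖ ^ α := Real.rpow_le_rpow hε.le hcon hα.le
    have h3 : 2 * (ε ^ α)⁻¹ * ε ^ α ≤ ‖H n (p n)‖ * ‖p n‖ ^ α := by gcongr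
    rw [mul_assoc, inv_mul_cancel₀ hεα.ne'] at h3
    linarith [hp1 n]
  have hlamt : Tendsto lam atTop atTop :=
    (tendsto_nhdsWithin_iff.2 ⟨hptend, Eventually.of_forall hp0⟩ :
      Tendsto (fun n => ‖p n‖) atTop (𝓝[>] 0)).inv_tendsto_nhdsGT_zero
  set g : ℕ → ℂ → ℂ := fun n z => (lam n ^ (-α) : ℝ) * H n (0 + lam n * z)⁻¹ with hg
  set G : ℕ → ℂ → ℂ := fun n w => (lam n ^ (-α) : ℝ) * H n (w * ‖p n‖) with hG
  have hgG : ∀ n, (fun z => G n z⁻¹) = g n := by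
    intro n
    ext z
    simp only [hg, hG, hlam, zero_add, mul_inv, Complex.ofReal_inv, inv_inv]
    rw [mul_comm (z⁻¹)]
  have hGg : ∀ n w, G n w = g n w⁻¹ := fun n w => by rw [← hgG]; simp only [inv_inv]
  have hgA : ∀ n, Admissible k q (g n) {z | r⁻¹ < lam n * ‖z‖} := fun n =>
    (hA n).comp_affine (by omega) (hlam0 n) fun z hz => by
      change r⁻¹ < ‖0 + lam n * z‖
      rw [zero_add, norm_mul, Complex.norm_real, Real.norm_of_nonneg (hlam0 n).le]
      exact hz
  have hgev : ∀ R : ℝ, 0 < R → ∀ᶠ n in atTop, Admissible k q (g n) {z | R < ‖z‖} := by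
    intro R hR
    filter_upwards [hlamt.eventually_ge_atTop (r⁻¹ / R)] with n hn
    refine (hgA n).mono fun z hz => ?_
    have hz' : R < ‖z‖ := hz
    change r⁻¹ < lam n * ‖z‖
    rw [div_le_iff₀ hR] at hn
    nlinarith [hlam0 n]
  obtain ⟨φ, hφ, hconv⟩ := exists_subseq_convergesOn_of_admissible hk hq (F := g) (D := {0}ᶜ)
    (isConnected_compl_singleton_of_one_lt_rank (by simp) 0).isPreconnected fun x hx => by
      have hx0 : 0 < ‖x‖ := norm_pos_iff.2 hx
      refine ⟨‖x‖ / 2, half_pos hx0, (hgev (‖x‖ / 2) (half_pos hx0)).mono fun n hn =>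
        hn.mono fun z hz => ?_⟩
      rw [mem_ball, dist_eq_norm, norm_sub_rev] at hz
      change ‖x‖ / 2 < ‖z‖
      linarith [norm_sub_norm_le x z]
  have hφt := hφ.tendsto_atTop
  have hcompl : ∀ w ∈ ({0}ᶜ : Set ℂ), w⁻¹ ∈ ({0}ᶜ : Set ℂ) := fun w hw => inv_ne_zero hw
  -- the limit is finite: the values at the points `p n / ‖p n‖` are bounded
  have hfin : ∀ n, ∃ z ∈ sphere (0 : ℂ) 1, ‖g n z‖ ≤ 1 := by
    intro n
    have hpn : p n ≠ 0 := norm_pos_iff.1 (hp0 n)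
    have hpc : ((‖p n‖ : ℝ) : ℂ) ≠ 0 := by exact_mod_cast (hp0 n).ne'
    refine ⟨(p n / ‖p n‖)⁻¹, ?_, ?_⟩
    · rw [mem_sphere_zero_iff_norm, norm_inv, norm_div, Complex.norm_real, norm_norm,
        div_self (hp0 n).ne', inv_one]
    · rw [← hGg, hG]
      simp only
      rw [div_mul_cancel₀ _ hpc, norm_mul, Complex.norm_real, Real.norm_of_nonneg
        (Real.rpow_pos_of_pos (hlam0 n) _).le, hlam, Real.inv_rpow (hp0 n).le,
        Real.rpow_neg (hp0 n).le, inv_inv, mul_comm]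
      exact hp1 n
  obtain ⟨γ, hγ⟩ := hconv.resolve_right fun hinf' => by
    obtain ⟨n, hn⟩ := (hinf'.eventually_forall_le (isCompact_sphere (0 : ℂ) 1)
      (fun z hz => ne_of_mem_sphere hz one_ne_zero) 2).exists
    obtain ⟨z, hz, hz1⟩ := hfin (φ n)
    linarith [hn z hz]
  have hGd : ∀ R : ℝ, ∀ᶠ n in atTop, DifferentiableOn ℂ (G n) (ball 0 R) := by
    intro R
    filter_upwards [hlamt.eventually_ge_atTop (R / r)] with n hn
    have hmaps : MapsTo (fun w : ℂ => w * ‖p n‖) (ball 0 R) (ball 0 r) := by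
      intro w hw
      rw [mem_ball_zero_iff] at hw ⊢
      rw [norm_mul, Complex.norm_real, norm_norm]
      rw [div_le_iff₀ hr, hlam, ← div_eq_inv_mul, le_div_iff₀ (hp0 n)] at hn
      nlinarith [hp0 n]
    exact ((hH n).comp (t := ball 0 r) (by fun_prop) hmaps).const_mul _
  have hGd' : ∀ R : ℝ, ∀ᶠ n in atTop, DifferentiableOn ℂ (G (φ n)) (ball 0 R) := fun R =>
    hφt.eventually (hGd R)
  obtain ⟨G', hG'⟩ := exists_tendstoLocallyUniformlyOn_univ (G := fun n => G (φ n)) hGd'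
    (g := fun w => γ w⁻¹) (by
      have := hγ.comp (fun w : ℂ => w⁻¹) (t := {0}ᶜ) hcompl
        (continuousOn_inv₀.mono fun w hw => hw)
      simpa only [Function.comp_def, ← hGg] using this)
  have hG'd : Differentiable ℂ G' := fun z => by
    have hz : z ∈ ball (0 : ℂ) (‖z‖ + 1) := by rw [mem_ball_zero_iff]; linarith
    exact ((hG'.mono (subset_univ _)).differentiableOn (hGd' (‖z‖ + 1))
      isOpen_ball).differentiableAt (isOpen_ball.mem_nhds hz)
  have hbig : ∀ w : ℂ, 1 < ‖w‖ → 1 ≤ ‖G' w‖ * ‖w‖ ^ α := by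
    intro w hw
    have hlim : Tendsto (fun n => ‖G (φ n) w‖ * ‖w‖ ^ α) atTop (𝓝 (‖G' w‖ * ‖w‖ ^ α)) :=
      (hG'.tendsto_at (mem_univ w)).norm.mul_const _
    refine ge_of_tendsto hlim (hφt.eventually (p := fun n => 1 ≤ ‖G n w‖ * ‖w‖ ^ α) ?_)
    have hw0 : 0 < ‖w‖ := by linarith
    filter_upwards [hptend.eventually (gt_mem_nhds (show 0 < r / 2 / ‖w‖ by positivity))]
      with n hn
    rw [lt_div_iff₀ hw0] at hn
    have hnorm : ‖w * ‖p n‖‖ = ‖w‖ * ‖p n‖ := by rw [norm_mul, Complex.norm_real, norm_norm]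
    have h1 := hpmax n (w * ‖p n‖) (by rw [hnorm]; nlinarith [hp0 n]) (by rw [hnorm]; linarith)
    rw [hnorm, Real.mul_rpow hw0.le (hp0 n).le] at h1
    rw [hG]
    simp only
    rw [norm_mul, Complex.norm_real, Real.norm_of_nonneg
        (Real.rpow_pos_of_pos (hlam0 n) _).le, hlam, Real.inv_rpow (hp0 n).le,
        Real.rpow_neg (hp0 n).le, inv_inv]
    linarith
  have hE : ExpType G' := expType_of_one_le_norm_mul hG'd k fun w hw => by
    refine (hbig w hw).trans (mul_le_mul_of_nonneg_left ?_ (norm_nonneg _))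
    rw [← Real.rpow_natCast]
    exact Real.rpow_le_rpow_of_exponent_le hw.le hαk.le
  have hM0 : ∀ f : ℂ → ℂ, diffMonomial (fun w => -w ^ 2) k q f 0 = 0 := fun f =>
    diffMonomial_eq_zero_of_eq_zero le_rfl hqk (derivation_iterate_zero hk f)
  have hMne : ∀ R : ℝ, ∀ᶠ n in atTop, ∀ w ∈ ball (0 : ℂ) R,
      diffMonomial (fun w => -w ^ 2) k q (G (φ n)) w ≠ 1 := by
    intro R
    refine hφt.eventually (p := fun n => ∀ w ∈ ball (0 : ℂ) R,
      diffMonomial (fun w => -w ^ 2) k q (G n) w ≠ 1) ?_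
    filter_upwards [hGd R, hgev (|R| + 1)⁻¹ (by positivity)] with n hn hgn w hw
    rcases eq_or_ne w 0 with rfl | hw0
    · rw [hM0]
      exact zero_ne_one
    · rw [diffMonomial_inv isOpen_ball hn hw hw0, hgG]
      refine hgn.3 _ ?_
      rw [mem_ball_zero_iff] at hw
      change (|R| + 1)⁻¹ < ‖w⁻¹‖
      rw [norm_inv]
      exact inv_strictAnti₀ (norm_pos_iff.2 hw0) (by linarith [le_abs_self R])
  have hne := (diffMonomial_ne_one_or_eq_one (by fun_prop) hGd' hMne hG').resolve_right
    fun h1 => by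
      have := h1 0
      rw [hM0] at this
      exact zero_ne_one this
  have hconst : ∀ w, G' w = G' 2 := fun w =>
    is_const_of_deriv_eq_zero hG'd (deriv_eq_zero_of_diffMonomial_ne_one hE hk hqk hne) w 2
  have hG'2 : 0 < ‖G' 2‖ := by
    refine norm_pos_iff.2 fun h0 => ?_
    have := hbig 2 (by norm_num)
    rw [h0, norm_zero, zero_mul] at this
    linarith
  have hunif := (tendstoLocallyUniformlyOn_iff_forall_isCompact isOpen_univ).1 hG'
    (closedBall 0 1) (subset_univ _) (isCompact_closedBall 0 1)
  refine ⟨φ, hφ, ?_⟩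
  filter_upwards [Metric.tendstoUniformlyOn_iff.1 hunif _ hG'2] with n hn w hw h0
  rw [mem_closedBall_zero_iff] at hw
  rcases le_or_gt ‖w‖ ‖p (φ n)‖ with hle | hgt
  · have hpc : ((‖p (φ n)‖ : ℝ) : ℂ) ≠ 0 := by exact_mod_cast (hp0 (φ n)).ne'
    have h1 := hn (w / ‖p (φ n)‖) (by
      rw [mem_closedBall_zero_iff, norm_div, Complex.norm_real, norm_norm]
      exact div_le_one_of_le₀ hle (norm_nonneg _))
    rw [hconst, hG] at h1
    simp only [div_mul_cancel₀ _ hpc, h0, mul_zero, dist_zero_right, lt_irrefl] at h1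
  · have h1 := hpmax (φ n) w hgt hw
    rw [h0, norm_zero, zero_mul] at h1
    linarith

/-- The theorem near `∞`, in the coordinate `w = 1 / z`. -/
theorem exists_subseq_convergesOn_of_admissible_inv {k : ℕ} (hk : 1 ≤ k) {q : ℕ → ℕ}
    (hq : 2 ≤ q 0) (hqk : 1 ≤ q k) {H : ℕ → ℂ → ℂ} {r : ℝ} (hr : 0 < r)
    (hH : ∀ n, DifferentiableOn ℂ (H n) (ball 0 r))
    (hA : ∀ n, Admissible k q (fun z => H n z⁻¹) {z | r⁻¹ < ‖z‖}) :
    ∃ φ : ℕ → ℕ, StrictMono φ ∧ ConvergesOn (fun n => H (φ n)) atTop (ball 0 (r / 2)) := by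
  have hρ : 0 < r / 2 := half_pos hr
  have hρr : closedBall (0 : ℂ) (r / 2) ⊆ ball 0 r := closedBall_subset_ball (half_lt_self hr)
  have hopen : IsOpen {z : ℂ | r⁻¹ < ‖z‖} := isOpen_lt continuous_const continuous_norm
  have hPo : IsOpen (ball (0 : ℂ) r \ {0}) := isOpen_ball.sdiff isClosed_singleton
  have hsphere : sphere (0 : ℂ) (r / 2) ⊆ ball 0 r \ {0} := fun w hw =>
    ⟨hρr (sphere_subset_closedBall hw), ne_of_mem_sphere hw hρ.ne'⟩
  have hmaps : MapsTo (fun w : ℂ => w⁻¹) (ball 0 r \ {0}) {z : ℂ | r⁻¹ < ‖z‖} := by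
    rintro w ⟨hw, hw0⟩
    rw [mem_ball_zero_iff] at hw
    change r⁻¹ < ‖w⁻¹‖
    rw [norm_inv]
    exact inv_strictAnti₀ (norm_pos_iff.2 hw0) hw
  have hcont : ContinuousOn (fun w : ℂ => w⁻¹) (ball 0 r \ {0}) :=
    continuousOn_inv₀.mono fun w hw => hw.2
  obtain ⟨φ, hφ, hconv⟩ := exists_subseq_convergesOn_of_admissible hk hq
    (F := fun n z => H n z⁻¹) (isPreconnected_lt_norm r⁻¹ (inv_pos.2 hr)) fun x hx => by
      obtain ⟨R, hR, hsub⟩ := Metric.isOpen_iff.1 hopen x hx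
      exact ⟨R, hR, Eventually.of_forall fun n => (hA n).mono hsub⟩
  rcases hconv with ⟨γ, hγ⟩ | hinf
  · have h1 := hγ.comp (fun w : ℂ => w⁻¹) hmaps hcont
    simp only [Function.comp_def, inv_inv] at h1
    obtain ⟨g, hg⟩ := exists_tendstoUniformlyOn_closedBall hρ
      (Eventually.of_forall fun n => (hH (φ n)).mono hρr)
      ((tendstoLocallyUniformlyOn_iff_forall_isCompact hPo).1 h1 _ hsphere (isCompact_sphere _ _))
    exact ⟨φ, hφ, Or.inl ⟨g, hg.tendstoLocallyUniformlyOn.mono ball_subset_closedBall⟩⟩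
  · have hinf' : TendstoInftyOn (fun n => H (φ n)) atTop (ball 0 r \ {0}) := by
      intro C w hw
      obtain ⟨t, ht, hn⟩ := hinf C w⁻¹ (hmaps hw)
      refine ⟨(fun w : ℂ => w⁻¹) ⁻¹' t, (hcont w hw).tendsto_nhdsWithin hmaps ht,
        hn.mono fun n hn y hy => ?_⟩
      simpa using hn y⁻¹ hy
    obtain ⟨ψ, hψ, hne⟩ := exists_subseq_ne_zero hk hq hqk hr (fun n => hH (φ n))
      (fun n => hA (φ n)) hinf'
    refine ⟨φ ∘ ψ, hφ.comp hψ, Or.inr fun C w hw => ⟨ball 0 (r / 2), self_mem_nhdsWithin, ?_⟩⟩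
    filter_upwards [hne, (hinf'.comp hψ.tendsto_atTop).eventually_forall_le
      (isCompact_sphere (0 : ℂ) (r / 2)) hsphere (max C 1)] with n hn hCn y hy
    exact (le_max_left C 1).trans (le_norm_of_le_norm_sphere hρ (by positivity)
      ((hH _).mono hρr) hn hCn (ball_subset_closedBall hy))

/-! ### The two charts of the sphere -/

theorem recip_zero : recip 0 = OnePoint.infty := if_pos rfl

theorem recip_of_ne_zero {w : ℂ} (hw : w ≠ 0) : recip w = ((w⁻¹ : ℂ) : OnePoint ℂ) := if_neg hw

/-- `recip` is a local homeomorphism; at `0` this says that the neighbourhoods of `∞` are the images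
of those of `0`. -/
theorem map_recip_nhds (w : ℂ) : map recip (𝓝 w) = 𝓝 (recip w) := by
  rcases eq_or_ne w 0 with rfl | hw
  · have h : map recip (𝓝[≠] (0 : ℂ)) = map (fun z : ℂ => (z : OnePoint ℂ)) (cocompact ℂ) := by
      rw [← cobounded_eq_cocompact, ← inv_nhdsNE_zero, ← Filter.map_inv, map_map]
      exact map_congr (eventually_mem_nhdsWithin.mono fun w hw => recip_of_ne_zero hw)
    rw [← nhdsNE_sup_pure, Filter.map_sup, map_pure, recip_zero, h, OnePoint.nhds_infty_eq,
      coclosedCompact_eq_cocompact]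
  · have h : recip =ᶠ[𝓝 w] fun w => ((w⁻¹ : ℂ) : OnePoint ℂ) :=
      (isOpen_ne.eventually_mem hw).mono fun w hw => recip_of_ne_zero hw
    rw [map_congr h, recip_of_ne_zero hw, OnePoint.nhds_coe_eq, nhds_inv₀ hw, ← Filter.map_inv, map_map]
    rfl

theorem recip_injective : Function.Injective recip := by
  intro a b h
  by_cases ha : a = 0 <;> by_cases hb : b = 0 <;> simp_all [recip]

theorem isOpenEmbedding_recip : IsOpenEmbedding recip :=
  .of_continuous_injective_isOpenMap (continuous_iff_continuousAt.2 fun w => (map_recip_nhds w).le)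
    recip_injective (isOpenMap_iff_nhds_le.2 fun w => (map_recip_nhds w).ge)

theorem isLindelof_onePoint (D : Set (OnePoint ℂ)) : IsLindelof D := by
  have h : D = (fun z : ℂ => (z : OnePoint ℂ)) '' ((fun z : ℂ => (z : OnePoint ℂ)) ⁻¹' D) ∪
      D ∩ {OnePoint.infty} := by
    ext p
    induction p using OnePoint.rec <;> simp
  rw [h]
  exact ((HereditarilyLindelofSpace.isLindelof _).image OnePoint.continuous_coe).union
    ((finite_singleton _).inter_of_right D).isLindelof

/-- Convergence in a chart `e` is convergence on the sphere. -/
theorem ConvergesOn.image {X Y : Type*} [TopologicalSpace X] [TopologicalSpace Y] [Nonempty X]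
    {e : X → Y} (he : IsEmbedding e) {F : ℕ → Y → ℂ} {L : Filter ℕ} {V : Set X}
    (h : ConvergesOn (fun n x => F n (e x)) L V) : ConvergesOn F L (e '' V) := by
  have hmem : ∀ {x : X} {t : Set X}, t ∈ 𝓝[V] x → e '' t ∈ 𝓝[e '' V] e x := fun {x t} ht => by
    rw [← he.map_nhdsWithin_eq]
    exact image_mem_map ht
  rcases h with ⟨g, hg⟩ | hinf
  · refine Or.inl ⟨fun y => g (Function.invFun e y), ?_⟩
    rintro u hu _ ⟨x, hx, rfl⟩
    obtain ⟨t, ht, H⟩ := hg u hu x hx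
    refine ⟨e '' t, hmem ht, H.mono ?_⟩
    rintro n hn _ ⟨y, hy, rfl⟩
    simp only [Function.leftInverse_invFun he.injective y]
    exact hn y hy
  · right
    rintro C _ ⟨x, hx, rfl⟩
    obtain ⟨t, ht, H⟩ := hinf C x hx
    refine ⟨e '' t, hmem ht, H.mono ?_⟩
    rintro n hn _ ⟨y, hy, rfl⟩
    exact hn y hy

theorem AnalyticOnSphere.analyticAt_recip {f : OnePoint ℂ → ℂ} {D : Set (OnePoint ℂ)}
    (hf : AnalyticOnSphere f D) {w : ℂ} (hw : recip w ∈ D) :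
    AnalyticAt ℂ (fun w => f (recip w)) w := by
  rcases eq_or_ne w 0 with rfl | hw0
  · exact hf.2 (recip_zero ▸ hw)
  · have h : (fun w => f (recip w)) =ᶠ[𝓝 w] (fun x : ℂ => f (x : OnePoint ℂ)) ∘ fun w => w⁻¹ :=
      (isOpen_ne.eventually_mem hw0).mono fun w hw => congrArg f (recip_of_ne_zero hw)
    exact ((hf.1 _ (recip_of_ne_zero hw0 ▸ hw)).comp (analyticAt_inv hw0)).congr h.symm

theorem AnalyticOnSphere.of_tendstoLocallyUniformlyOn {F : ℕ → OnePoint ℂ → ℂ}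
    {g : OnePoint ℂ → ℂ} {D : Set (OnePoint ℂ)} (hD : IsOpen D)
    (hF : ∀ n, AnalyticOnSphere (F n) D) (h : TendstoLocallyUniformlyOn F g atTop D) :
    AnalyticOnSphere g D := by
  have h1 : ∀ e : ℂ → OnePoint ℂ, Continuous e →
      (∀ n w, e w ∈ D → AnalyticAt ℂ (fun w => F n (e w)) w) →
      ∀ w, e w ∈ D → AnalyticAt ℂ (fun w => g (e w)) w := by
    intro e he hFe w hw
    have hV : IsOpen (e ⁻¹' D) := hD.preimage he
    have h2 := h.comp e (mapsTo_preimage e D) he.continuousOn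
    exact (h2.differentiableOn (Eventually.of_forall fun n w hw =>
      (hFe n w hw).differentiableAt.differentiableWithinAt) hV).analyticAt (hV.mem_nhds hw)
  refine ⟨fun z hz => h1 _ OnePoint.continuous_coe (fun n w hw => (hF n).1 w hw) z hz,
    fun hi => h1 recip isOpenEmbedding_recip.continuous (fun n w hw => (hF n).analyticAt_recip hw)
      0 (recip_zero ▸ hi)⟩

/-! ### The chordal distance -/

theorem chordal_coe_coe_le (z w : ℂ) : chordal (z : OnePoint ℂ) (w : OnePoint ℂ) ≤ 2 * ‖z - w‖ := by
  have h : ∀ a : ℂ, 1 ≤ √(1 + ‖a‖ ^ 2) := fun a => Real.one_le_sqrt.2 (by nlinarith [sq_nonneg ‖a‖])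
  exact div_le_self (by positivity) (one_le_mul_of_one_le_of_one_le (h z) (h w))

theorem chordal_coe_infty_le (z : ℂ) {C : ℝ} (hC : 0 < C) (hz : C ≤ ‖z‖) :
    chordal (z : OnePoint ℂ) OnePoint.infty ≤ 2 / C :=
  div_le_div_of_nonneg_left zero_le_two hC
    (hz.trans (Real.le_sqrt_of_sq_le (by linarith)))

theorem chordal_nonneg (p q : OnePoint ℂ) : 0 ≤ chordal p q := by
  rcases p with _ | z <;> rcases q with _ | w <;> simp only [chordal] <;> positivity

theorem tendstoSpherically_of_tendstoLocallyUniformlyOn {F : ℕ → OnePoint ℂ → ℂ}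
    {g : OnePoint ℂ → ℂ} {D : Set (OnePoint ℂ)} (h : TendstoLocallyUniformlyOn F g atTop D) :
    TendstoSpherically F (fun p => (g p : OnePoint ℂ)) D := by
  refine Metric.tendstoLocallyUniformlyOn_iff.2 fun ε hε p hp => ?_
  obtain ⟨t, ht, H⟩ := Metric.tendstoLocallyUniformlyOn_iff.1 h (ε / 2) (half_pos hε) p hp
  refine ⟨t, ht, H.mono fun n hn y hy => ?_⟩
  have h1 := hn y hy
  rw [dist_comm, dist_eq_norm] at h1
  rw [dist_comm, dist_zero_right, Real.norm_of_nonneg (chordal_nonneg _ _)]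
  linarith [chordal_coe_coe_le (F n y) (g y)]

theorem TendstoInftyOn.tendstoSpherically {F : ℕ → OnePoint ℂ → ℂ} {D : Set (OnePoint ℂ)}
    (h : TendstoInftyOn F atTop D) : TendstoSpherically F (fun _ => OnePoint.infty) D := by
  refine Metric.tendstoLocallyUniformlyOn_iff.2 fun ε hε p hp => ?_
  obtain ⟨t, ht, H⟩ := h (4 / ε) p hp
  refine ⟨t, ht, H.mono fun n hn y hy => ?_⟩
  rw [dist_comm, dist_zero_right, Real.norm_of_nonneg (chordal_nonneg _ _)]
  refine (chordal_coe_infty_le _ (by positivity) (hn y hy)).trans_lt ?_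
  rw [div_div_eq_mul_div]
  linarith

/-! ### Normality on a domain of the sphere -/

theorem admissible_coe {f : OnePoint ℂ → ℂ} {D : Set (OnePoint ℂ)} (hf : AnalyticOnSphere f D)
    {k : ℕ} {q : ℕ → ℕ} (hzero : ∀ p ∈ D, f p = 0 → (k : ℕ∞) ≤ zeroMult f p)
    (hne : ∀ p ∈ D, monomial k q f p ≠ 1) :
    Admissible k q (fun x : ℂ => f (x : OnePoint ℂ)) {x : ℂ | (x : OnePoint ℂ) ∈ D} where
  differentiableOn z hz := (hf.1 z hz).differentiableAt.differentiableWithinAt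
  zeros z hz h0 := (natCast_le_analyticOrderAt_iff_iteratedDeriv_eq_zero (hf.1 z hz)).1
    (hzero z hz h0)
  ne_one z hz := by
    have h := hne z hz
    simp only [monomial, sderiv_iterate_coe] at h
    simpa only [diffMonomial, derivation_one_iterate] using h

theorem Admissible.congr {k : ℕ} {q : ℕ → ℕ} {f g : ℂ → ℂ} {U : Set ℂ} (hU : IsOpen U)
    (h : Admissible k q f U) (hfg : EqOn f g U) : Admissible k q g U where
  differentiableOn := h.differentiableOn.congr hfg.symm
  zeros z hz h0 j hj := by
    rw [← (hfg.eventuallyEq_of_mem (hU.mem_nhds hz)).iteratedDeriv_eq j]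
    exact h.zeros z hz ((hfg hz).trans h0) j hj
  ne_one z hz := by
    rw [← diffMonomial_congr (hfg.eventuallyEq_of_mem (hU.mem_nhds hz)) k q]
    exact h.ne_one z hz

/-- Normality at the points of `D`; at `∞` it is obtained in the chart `recip`. -/
theorem exists_isOpen_subseq_convergesOn {D : Set (OnePoint ℂ)} (hD : IsOpen D) {k : ℕ}
    (hk : 1 ≤ k) {q : ℕ → ℕ} (hq : 2 ≤ q 0) (hqk : 1 ≤ q k) {F : ℕ → OnePoint ℂ → ℂ}
    (hF : ∀ n, AnalyticOnSphere (F n) D)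
    (hA : ∀ n, Admissible k q (fun x : ℂ => F n (x : OnePoint ℂ)) {x : ℂ | (x : OnePoint ℂ) ∈ D})
    {p : OnePoint ℂ} (hp : p ∈ D) :
    ∃ U, IsOpen U ∧ p ∈ U ∧ ∀ φ : ℕ → ℕ, StrictMono φ → ∃ ψ : ℕ → ℕ, StrictMono ψ ∧
      ConvergesOn (fun n => F (φ (ψ n))) atTop U := by
  induction p using OnePoint.rec with
  | infty =>
    have hV : IsOpen (recip ⁻¹' D) := hD.preimage isOpenEmbedding_recip.continuous
    obtain ⟨r, hr, hsub⟩ := Metric.isOpen_iff.1 hV 0 (by rwa [mem_preimage, recip_zero])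
    refine ⟨recip '' ball 0 (r / 2), isOpenEmbedding_recip.isOpenMap _ isOpen_ball,
      ⟨0, mem_ball_self (half_pos hr), recip_zero⟩, fun φ _ => ?_⟩
    obtain ⟨ψ, hψ, hc⟩ := exists_subseq_convergesOn_of_admissible_inv hk hq hqk hr
      (H := fun n w => F (φ n) (recip w))
      (fun n w hw => ((hF _).analyticAt_recip (hsub hw)).differentiableAt.differentiableWithinAt)
      fun n => by
        have hne : ∀ z : ℂ, r⁻¹ < ‖z‖ → z ≠ 0 := fun z hz =>
          norm_pos_iff.1 ((inv_pos.2 hr).trans hz)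
        have hrec : ∀ z : ℂ, r⁻¹ < ‖z‖ → recip z⁻¹ = (z : OnePoint ℂ) := fun z hz => by
          rw [recip_of_ne_zero (inv_ne_zero (hne z hz)), inv_inv]
        refine ((hA (φ n)).mono fun z hz => ?_).congr
          (isOpen_lt continuous_const continuous_norm) fun z hz => ?_
        · have hz' : z⁻¹ ∈ ball (0 : ℂ) r := by
            rw [mem_ball_zero_iff, norm_inv]
            exact inv_lt_of_inv_lt₀ hr hz
          have := hsub hz'
          rwa [mem_preimage, hrec z hz] at this
        · exact congrArg (F (φ n)) (hrec z hz).symm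
    exact ⟨ψ, hψ, hc.image isOpenEmbedding_recip.isEmbedding⟩
  | coe x =>
    obtain ⟨R, hR, hsub⟩ := Metric.isOpen_iff.1 (hD.preimage OnePoint.continuous_coe) x hp
    refine ⟨(fun z : ℂ => (z : OnePoint ℂ)) '' ball x (R / 64),
      OnePoint.isOpenEmbedding_coe.isOpenMap _ isOpen_ball,
      ⟨x, mem_ball_self (by positivity), rfl⟩, fun φ _ => ?_⟩
    obtain ⟨ψ, hψ, hc⟩ := exists_subseq_convergesOn_ball hk hq hR (x := x)
      (F := fun n z => F (φ n) (z : OnePoint ℂ))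
      (Eventually.of_forall fun n => (hA (φ n)).mono hsub)
    exact ⟨ψ, hψ, hc.image OnePoint.isOpenEmbedding_coe.isEmbedding⟩

end SphereNormal

theorem theorem5p1 (D : Set (OnePoint ℂ)) (hDo : IsOpen D) (hDc : IsConnected D)
    (𝓕 : Set (OnePoint ℂ → ℂ)) (h𝓕 : ∀ f ∈ 𝓕, SphereNormal.AnalyticOnSphere f D)
    (k : ℕ) (hk : 1 ≤ k) (q : ℕ → ℕ) (hq0 : 3 ≤ q 0) (hqk : 1 ≤ q k)
    (hzero : ∀ f ∈ 𝓕, ∀ p ∈ D, f p = 0 → (k : ℕ∞) ≤ SphereNormal.zeroMult f p)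
    (hne : ∀ f ∈ 𝓕, ∀ p ∈ D, SphereNormal.monomial k q f p ≠ 1) :
    SphereNormal.IsNormalOn 𝓕 D := by
  intro F hF
  have hq : 2 ≤ q 0 := by omega
  obtain ⟨φ, hφ, hc⟩ := SphereNormal.exists_subseq_convergesOn (F := F)
    (SphereNormal.isLindelof_onePoint D) hDc.isPreconnected fun p hp =>
      SphereNormal.exists_isOpen_subseq_convergesOn hDo hk hq hqk (fun n => h𝓕 _ (hF n))
        (fun n => SphereNormal.admissible_coe (h𝓕 _ (hF n)) (hzero _ (hF n)) (hne _ (hF n))) hp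
  refine ⟨φ, hφ, hc.imp (fun ⟨g, hg⟩ => ⟨g, ?_, ?_⟩) fun h => h.tendstoSpherically⟩
  · exact .of_tendstoLocallyUniformlyOn hDo (fun n => h𝓕 _ (hF (φ n))) hg
  · exact SphereNormal.tendstoSpherically_of_tendstoLocallyUniformlyOn hg
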